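/- Let $\mathcal T_\delta$ ($\delta\in\mathbb C$) be the strict $\mathbb C$-linear monoidal category generated by one object $\mathsf g$ and four morphisms $m\colon \mathsf g^{\otimes 2}\to\mathsf g$ (trivalent vertex), $x\colon \mathsf g^{\otimes 2}\to\mathsf g^{\otimes 2}$ (crossing), $u\colon \mathbf 1\to\mathsf g^{\otimes 2}$ (cup), $c\colon \mathsf g^{\otimes 2}\to\mathbf 1$ (cap), subject to the following relations, where $1=1_{\mathsf g}$ and $s:=(1\otimes m)\circ(u\otimes 1)\colon\mathsf g\to\mathsf g^{\otimes 2}$: - $(c\otimes 1)\circ(1\otimes u)=1=(1\otimes c)\circ(u\otimes 1)$, $\ s=(m\otimes 1)\circ(1\otimes u)$, $\ (1\otimes c)\circ(x\otimes 1)=(c\otimes 1)\circ(1\otimes x)$; - $x\circ x=1\otimes 1$, $\ (x\otimes 1)(1\otimes x)(x\otimes 1)=(1\otimes x)(x\otimes 1)(1\otimes x)$, $\ (1\otimes m)(x\otimes 1)(1\otimes x)=x\circ(m\otimes 1)$, $\ (1\otimes x)(x\otimes 1)(1\otimes s)=(s\otimes 1)\circ x$; - $c\circ x=c$, $\ m\circ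 x=-m$, $\ m\circ s=1$, $\ c\circ u=\delta\, 1_{\mathbf 1}$. Let $\mathcal I$ be a tensor ideal of $\mathcal T_\delta$ (a family of subspaces of the hom-spaces closed under composition with arbitrary morphisms and under tensoring with identities on either side) such that the quotient $\mathcal T_\delta/\mathcal I$, with hom-spaces $\mathcal T_\delta(X,Y)/\mathcal I(X,Y)$, is nontrivial (not all of its morphisms are zero) and such that the Jacobi identity $$(m\otimes 1)(1\otimes x)(s\otimes 1)\;=\;s\circ m-(m\otimes 1)(1\otimes s)$$ holds in $\mathcal T_\delta/\mathcal I$. Assume $\delta\notin\{-2,\,0,\,3,\,\tfrac{15+3\sqrt5}{4},\,\tfrac{15-3\sqrt5}{4}\}$. Then the following 16 morphisms are linearly independent in $(\mathcal T_\delta/\mathcal I)(\mathsf g^{\otimes 2},\mathsf g^{\otimes 3})$: 1. $(1\otimes m\otimes 1)(s\otimes s)$; 2. $(s\otimes 1)\,s\,m$; 3. $(1\otimes s)\,s\,m$; 4. $(1\otimes s)(1\otimes m)(s\otimes 1)$; 5. $(s\otimes 1)(m\otimes 1)(1\otimes s)$; 6. $(1\otimes s)\,u\,c$; 7. $1\otimes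 s$; 8. $s\otimes 1$; 9. $u\otimes m$; 10. $m\otimes u$; 11. $(1\otimes x)(u\otimes 1)\,m$; 12. $(1\otimes x)(s\otimes 1)$; 13. $(x\otimes 1)(1\otimes s)$; 14. $(s\otimes 1)\,x$; 15. $(1\otimes s)\,x$; 16. $(1\otimes m\otimes 1)(s\otimes s)\,x$. -/

import Mathlib

open CategoryTheory MonoidalCategory

universe u

namespace Trivalent

/-- Formal string diagrams over `k` with `m` strands at the bottom and `n` strands at the top:
the terms built from the four generating morphisms (the trivalent vertex `merge`, the crossing
`cross`, the cup and the cap) by identities, composition, tensor product and `k`-linear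
combinations. `comp f g` is "first `f` (below), then `g` (above)"; `tensor f g` puts `f` to the
left of `g`. -/
inductive Tm (k : Type u) : ℕ → ℕ → Type u
  | idn (n : ℕ) : Tm k n n
  | comp {l m n : ℕ} (f : Tm k l m) (g : Tm k m n) : Tm k l n
  | tensor {m n m' n' : ℕ} (f : Tm k m n) (g : Tm k m' n') : Tm k (m + m') (n + n')
  | merge : Tm k 2 1
  | cross : Tm k 2 2
  | cup : Tm k 0 2
  | cap : Tm k 2 0
  | zero (m n : ℕ) : Tm k m n
  | add {m n : ℕ} (f g : Tm k m n) : Tm k m n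
  | smul {m n : ℕ} (c : k) (f : Tm k m n) : Tm k m n

notation:70 f:71 " ≫ᵗ " g:70 => Tm.comp (f :) (g :)
notation:75 f:76 " ⊗ᵗ " g:75 => Tm.tensor (f :) (g :)

namespace Tm

variable {k : Type u}

/-- Transport of a term along equalities of the numbers of strands. -/
def cast {m n m' n' : ℕ} (hm : m = m') (hn : n = n') (f : Tm k m n) : Tm k m' n' :=
  hm ▸ hn ▸ f

/-- The downward trivalent vertex, obtained from `merge` by bending its left leg with a cup. -/
def split : Tm k 1 2 := (cup ⊗ᵗ idn 1) ≫ᵗ (idn 1 ⊗ᵗ merge)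

/-- The morphism `go ⊗ go → go ⊗ go` shaped like the letter I: merge, then split. -/
def Imor : Tm k 2 2 := merge ≫ᵗ split

/-- The morphism `go ⊗ go → go ⊗ go` shaped like the letter H. -/
def Hmor : Tm k 2 2 := (idn 1 ⊗ᵗ split) ≫ᵗ (merge ⊗ᵗ idn 1)

/-- The H-shaped morphism with the two strands on its right-hand side crossed. -/
def dotcross : Tm k 2 2 := (split ⊗ᵗ idn 1) ≫ᵗ (idn 1 ⊗ᵗ cross) ≫ᵗ (merge ⊗ᵗ idn 1)

end Tm

open Tm in
/-- The equivalence relation on terms that presents the strict `k`-linear monoidal category with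
one generating object, four generating morphisms and the relations listed at the end. -/
inductive Rel {k : Type u} [CommRing k] (δ α : k) : (m n : ℕ) → Tm k m n → Tm k m n → Prop
  -- equivalence relation, compatible with all operations
  | refl {m n} (f : Tm k m n) : Rel δ α m n f f
  | symm {m n} {f g : Tm k m n} : Rel δ α m n f g → Rel δ α m n g f
  | trans {m n} {f g h : Tm k m n} : Rel δ α m n f g → Rel δ α m n g h → Rel δ α m n f h
  | comp_congr {l m n} {f f' : Tm k l m} {g g' : Tm k m n} :
      Rel δ α l m f f' → Rel δ α m n g g' → Rel δ α l n (f ≫ᵗ g) (f' ≫ᵗ g')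
  | tensor_congr {m n m' n'} {f f' : Tm k m n} {g g' : Tm k m' n'} :
      Rel δ α m n f f' → Rel δ α m' n' g g' →
        Rel δ α (m + m') (n + n') (f ⊗ᵗ g) (f' ⊗ᵗ g')
  | add_congr {m n} {f f' g g' : Tm k m n} :
      Rel δ α m n f f' → Rel δ α m n g g' → Rel δ α m n (add f g) (add f' g')
  | smul_congr {m n} (c : k) {f f' : Tm k m n} :
      Rel δ α m n f f' → Rel δ α m n (smul c f) (smul c f')
  -- hom-sets are `k`-modules
  | add_assoc {m n} (f g h : Tm k m n) : Rel δ α m n (add (add f g) h) (add f (add g h))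
  | add_comm {m n} (f g : Tm k m n) : Rel δ α m n (add f g) (add g f)
  | zero_add {m n} (f : Tm k m n) : Rel δ α m n (add (zero m n) f) f
  | zero_smul {m n} (f : Tm k m n) : Rel δ α m n (smul 0 f) (zero m n)
  | one_smul {m n} (f : Tm k m n) : Rel δ α m n (smul 1 f) f
  | mul_smul {m n} (c d : k) (f : Tm k m n) :
      Rel δ α m n (smul (c * d) f) (smul c (smul d f))
  | add_smul {m n} (c d : k) (f : Tm k m n) :
      Rel δ α m n (smul (c + d) f) (add (smul c f) (smul d f))
  | smul_add {m n} (c : k) (f g : Tm k m n) :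
      Rel δ α m n (smul c (add f g)) (add (smul c f) (smul c g))
  -- composition and tensor product are `k`-bilinear
  | add_comp {l m n} (f f' : Tm k l m) (g : Tm k m n) :
      Rel δ α l n (add f f' ≫ᵗ g) (add (f ≫ᵗ g) (f' ≫ᵗ g))
  | comp_add {l m n} (f : Tm k l m) (g g' : Tm k m n) :
      Rel δ α l n (f ≫ᵗ add g g') (add (f ≫ᵗ g) (f ≫ᵗ g'))
  | smul_comp {l m n} (c : k) (f : Tm k l m) (g : Tm k m n) :
      Rel δ α l n (smul c f ≫ᵗ g) (smul c (f ≫ᵗ g))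
  | comp_smul {l m n} (c : k) (f : Tm k l m) (g : Tm k m n) :
      Rel δ α l n (f ≫ᵗ smul c g) (smul c (f ≫ᵗ g))
  | add_tensor {m n m' n'} (f f' : Tm k m n) (g : Tm k m' n') :
      Rel δ α (m + m') (n + n') (add f f' ⊗ᵗ g) (add (f ⊗ᵗ g) (f' ⊗ᵗ g))
  | tensor_add {m n m' n'} (f : Tm k m n) (g g' : Tm k m' n') :
      Rel δ α (m + m') (n + n') (f ⊗ᵗ add g g') (add (f ⊗ᵗ g) (f ⊗ᵗ g'))
  | smul_tensor {m n m' n'} (c : k) (f : Tm k m n) (g : Tm k m' n') :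
      Rel δ α (m + m') (n + n') (smul c f ⊗ᵗ g) (smul c (f ⊗ᵗ g))
  | tensor_smul {m n m' n'} (c : k) (f : Tm k m n) (g : Tm k m' n') :
      Rel δ α (m + m') (n + n') (f ⊗ᵗ smul c g) (smul c (f ⊗ᵗ g))
  -- category axioms
  | id_comp {m n} (f : Tm k m n) : Rel δ α m n (idn m ≫ᵗ f) f
  | comp_id {m n} (f : Tm k m n) : Rel δ α m n (f ≫ᵗ idn n) f
  | comp_assoc {l m n p} (f : Tm k l m) (g : Tm k m n) (h : Tm k n p) :
      Rel δ α l p ((f ≫ᵗ g) ≫ᵗ h) (f ≫ᵗ (g ≫ᵗ h))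
  -- strict monoidal category axioms
  | id_tensor_id (m n : ℕ) : Rel δ α (m + n) (m + n) (idn m ⊗ᵗ idn n) (idn (m + n))
  | interchange {l m n l' m' n'} (f : Tm k l m) (g : Tm k m n) (f' : Tm k l' m')
      (g' : Tm k m' n') :
      Rel δ α (l + l') (n + n') ((f ≫ᵗ g) ⊗ᵗ (f' ≫ᵗ g')) ((f ⊗ᵗ f') ≫ᵗ (g ⊗ᵗ g'))
  | tensor_assoc {m n m' n' m'' n''} (f : Tm k m n) (g : Tm k m' n') (h : Tm k m'' n'') :
      Rel δ α (m + (m' + m'')) (n + (n' + n''))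
        (cast (Nat.add_assoc m m' m'') (Nat.add_assoc n n' n'') ((f ⊗ᵗ g) ⊗ᵗ h))
        (f ⊗ᵗ (g ⊗ᵗ h))
  | one_tensor {m n} (f : Tm k m n) :
      Rel δ α m n (cast (Nat.zero_add m) (Nat.zero_add n) (idn 0 ⊗ᵗ f)) f
  | tensor_one {m n} (f : Tm k m n) :
      Rel δ α m n (cast (Nat.add_zero m) (Nat.add_zero n) (f ⊗ᵗ idn 0)) f
  -- the cup and the cap are adjoint; rotation of the trivalent vertex; the cap slides over strands
  | zigzag_left : Rel δ α 1 1 ((idn 1 ⊗ᵗ cup) ≫ᵗ (cap ⊗ᵗ idn 1)) (idn 1)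
  | zigzag_right : Rel δ α 1 1 ((cup ⊗ᵗ idn 1) ≫ᵗ (idn 1 ⊗ᵗ cap)) (idn 1)
  | rotate : Rel δ α 1 2 split ((idn 1 ⊗ᵗ cup) ≫ᵗ (merge ⊗ᵗ idn 1))
  | cap_slide : Rel δ α 3 1 ((cross ⊗ᵗ idn 1) ≫ᵗ (idn 1 ⊗ᵗ cap)) ((idn 1 ⊗ᵗ cross) ≫ᵗ (cap ⊗ᵗ idn 1))
  -- symmetric braiding, natural with respect to the trivalent vertices
  | cross_cross : Rel δ α 2 2 (cross ≫ᵗ cross) (idn 2)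
  | braid : Rel δ α 3 3
      ((cross ⊗ᵗ idn 1) ≫ᵗ (idn 1 ⊗ᵗ cross) ≫ᵗ (cross ⊗ᵗ idn 1))
      ((idn 1 ⊗ᵗ cross) ≫ᵗ (cross ⊗ᵗ idn 1) ≫ᵗ (idn 1 ⊗ᵗ cross))
  | merge_slide : Rel δ α 3 2
      ((idn 1 ⊗ᵗ cross) ≫ᵗ (cross ⊗ᵗ idn 1) ≫ᵗ (idn 1 ⊗ᵗ merge)) ((merge ⊗ᵗ idn 1) ≫ᵗ cross)
  | split_slide : Rel δ α 2 3
      ((idn 1 ⊗ᵗ split) ≫ᵗ (cross ⊗ᵗ idn 1) ≫ᵗ (idn 1 ⊗ᵗ cross)) (cross ≫ᵗ (split ⊗ᵗ idn 1))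
  -- symmetric form, skew-symmetric product, bigon and circle evaluation
  | cross_cap : Rel δ α 2 0 (cross ≫ᵗ cap) cap
  | cross_merge : Rel δ α 2 1 (cross ≫ᵗ merge) (smul (-1) merge)
  | bigon : Rel δ α 1 1 (split ≫ᵗ merge) (smul α (idn 1))
  | circle : Rel δ α 0 0 (cup ≫ᵗ cap) (smul δ (idn 0))

/-- The strict `k`-linear monoidal category presented by `Rel δ α`. Its objects are the tensor
powers of the generating object: `⟨n⟩` is the `n`-th tensor power. -/
structure Tcat (k : Type u) [CommRing k] (δ α : k) : Type where
  /-- the number of tensor factors -/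
  strands : ℕ

/-- Equality of morphisms of `Tcat`, as a setoid on terms. -/
def setoid {k : Type u} [CommRing k] (δ α : k) (m n : ℕ) : Setoid (Tm k m n) where
  r := Rel δ α m n
  iseqv := ⟨Rel.refl, Rel.symm, Rel.trans⟩

namespace Tcat

variable {k : Type u} [CommRing k] {δ α : k}

instance : Category.{u} (Tcat k δ α) where
  Hom X Y := Quotient (setoid δ α X.strands Y.strands)
  id X := Quotient.mk _ (Tm.idn X.strands)
  comp := Quotient.map₂ Tm.comp fun _ _ hf _ _ hg => Rel.comp_congr hf hg
  id_comp := by rintro _ _ ⟨f⟩; exact Quotient.sound (Rel.id_comp f)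
  comp_id := by rintro _ _ ⟨f⟩; exact Quotient.sound (Rel.comp_id f)
  assoc := by rintro _ _ _ _ ⟨f⟩ ⟨g⟩ ⟨h⟩; exact Quotient.sound (Rel.comp_assoc f g h)

variable (δ α) in
/-- The morphism of `Tcat k δ α` represented by a term. -/
def of {m n : ℕ} (f : Tm k m n) : (⟨m⟩ : Tcat k δ α) ⟶ ⟨n⟩ := Quotient.mk (setoid δ α m n) f

theorem of_eq {m n : ℕ} {f g : Tm k m n} (h : Rel δ α m n f g) : of δ α f = of δ α g :=
  Quotient.sound h

theorem of_cast {m n m' n' : ℕ} (hm : m = m') (hn : n = n') (f : Tm k m n) :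
    of δ α (Tm.cast hm hn f) =
      eqToHom (congrArg Tcat.mk hm.symm) ≫ of δ α f ≫ eqToHom (congrArg Tcat.mk hn) := by
  subst hm hn
  simp [Tm.cast]

instance (X Y : Tcat k δ α) : AddCommGroup (X ⟶ Y) where
  add := Quotient.map₂ Tm.add fun _ _ hf _ _ hg => Rel.add_congr hf hg
  zero := Quotient.mk _ (Tm.zero _ _)
  neg := Quotient.map (Tm.smul (-1)) fun _ _ hf => Rel.smul_congr _ hf
  nsmul := letI : Zero (X ⟶ Y) := ⟨Quotient.mk _ (Tm.zero _ _)⟩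
    letI : Add (X ⟶ Y) := ⟨Quotient.map₂ Tm.add fun _ _ hf _ _ hg => Rel.add_congr hf hg⟩
    nsmulRec
  zsmul := letI : Zero (X ⟶ Y) := ⟨Quotient.mk _ (Tm.zero _ _)⟩
    letI : Add (X ⟶ Y) := ⟨Quotient.map₂ Tm.add fun _ _ hf _ _ hg => Rel.add_congr hf hg⟩
    letI : Neg (X ⟶ Y) := ⟨Quotient.map (Tm.smul (-1)) fun _ _ hf => Rel.smul_congr _ hf⟩
    zsmulRec
  add_assoc := by rintro ⟨f⟩ ⟨g⟩ ⟨h⟩; exact Quotient.sound (Rel.add_assoc f g h)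
  add_comm := by rintro ⟨f⟩ ⟨g⟩; exact Quotient.sound (Rel.add_comm f g)
  zero_add := by rintro ⟨f⟩; exact Quotient.sound (Rel.zero_add f)
  add_zero := by
    rintro ⟨f⟩; exact Quotient.sound ((Rel.add_comm _ _).trans (Rel.zero_add f))
  neg_add_cancel := by
    rintro ⟨f⟩
    refine Quotient.sound (Rel.trans (Rel.add_congr (Rel.refl _) (Rel.one_smul f).symm) ?_)
    refine (Rel.add_smul (-1) 1 f).symm.trans ?_
    rw [neg_add_cancel]
    exact Rel.zero_smul f

instance (X Y : Tcat k δ α) : Module k (X ⟶ Y) where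
  smul c := Quotient.map (Tm.smul c) fun _ _ hf => Rel.smul_congr c hf
  one_smul := by rintro ⟨f⟩; exact Quotient.sound (Rel.one_smul f)
  mul_smul := by rintro c d ⟨f⟩; exact Quotient.sound (Rel.mul_smul c d f)
  smul_add := by rintro c ⟨f⟩ ⟨g⟩; exact Quotient.sound (Rel.smul_add c f g)
  add_smul := by rintro c d ⟨f⟩; exact Quotient.sound (Rel.add_smul c d f)
  zero_smul := by rintro ⟨f⟩; exact Quotient.sound (Rel.zero_smul f)
  smul_zero := by
    intro c
    refine Quotient.sound ((Rel.smul_congr c (Rel.zero_smul (Tm.zero _ _)).symm).trans ?_)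
    refine (Rel.mul_smul c 0 _).symm.trans ?_
    rw [mul_zero]
    exact Rel.zero_smul _

instance : Preadditive (Tcat k δ α) where
  add_comp := by rintro _ _ _ ⟨f⟩ ⟨f'⟩ ⟨g⟩; exact Quotient.sound (Rel.add_comp f f' g)
  comp_add := by rintro _ _ _ ⟨f⟩ ⟨g⟩ ⟨g'⟩; exact Quotient.sound (Rel.comp_add f g g')

instance : Linear k (Tcat k δ α) where
  smul_comp := by rintro _ _ _ c ⟨f⟩ ⟨g⟩; exact Quotient.sound (Rel.smul_comp c f g)
  comp_smul := by rintro _ _ _ ⟨f⟩ c ⟨g⟩; exact Quotient.sound (Rel.comp_smul c f g)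

/-- The tensor product of morphisms of `Tcat`. -/
def tensorMor {X Y X' Y' : Tcat k δ α} (f : X ⟶ Y) (g : X' ⟶ Y') :
    (⟨X.strands + X'.strands⟩ : Tcat k δ α) ⟶ ⟨Y.strands + Y'.strands⟩ :=
  Quotient.map₂ Tm.tensor (fun _ _ hf _ _ hg => Rel.tensor_congr hf hg) f g

theorem tensorMor_eqToHom {X Y X' Y' : Tcat k δ α} (h : X = Y) (h' : X' = Y') :
    tensorMor (eqToHom h) (eqToHom h') = eqToHom (by rw [h, h']) := by
  subst h h'
  exact Quotient.sound (Rel.id_tensor_id _ _)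

theorem tensorMor_assoc {X Y X' Y' X'' Y'' : Tcat k δ α} (f : X ⟶ Y) (g : X' ⟶ Y')
    (h : X'' ⟶ Y'') :
    tensorMor (tensorMor f g) h ≫
        eqToHom (congrArg Tcat.mk (Nat.add_assoc Y.strands Y'.strands Y''.strands)) =
      eqToHom (congrArg Tcat.mk (Nat.add_assoc X.strands X'.strands X''.strands)) ≫
        tensorMor f (tensorMor g h) := by
  obtain ⟨f⟩ := f
  obtain ⟨g⟩ := g
  obtain ⟨h⟩ := h
  have e := of_eq (δ := δ) (α := α) (Rel.tensor_assoc f g h)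
  rw [of_cast, eqToHom_comp_iff] at e
  exact e

theorem one_tensorMor {X Y : Tcat k δ α} (f : X ⟶ Y) :
    tensorMor (𝟙 (⟨0⟩ : Tcat k δ α)) f ≫ eqToHom (congrArg Tcat.mk (Nat.zero_add Y.strands)) =
      eqToHom (congrArg Tcat.mk (Nat.zero_add X.strands)) ≫ f := by
  obtain ⟨f⟩ := f
  have e := of_eq (δ := δ) (α := α) (Rel.one_tensor f)
  rw [of_cast, eqToHom_comp_iff] at e
  exact e

theorem tensorMor_one {X Y : Tcat k δ α} (f : X ⟶ Y) :
    tensorMor f (𝟙 (⟨0⟩ : Tcat k δ α)) ≫ eqToHom (congrArg Tcat.mk (Nat.add_zero Y.strands)) =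
      eqToHom (congrArg Tcat.mk (Nat.add_zero X.strands)) ≫ f := by
  obtain ⟨f⟩ := f
  have e := of_eq (δ := δ) (α := α) (Rel.tensor_one f)
  rw [of_cast, eqToHom_comp_iff] at e
  exact e

theorem tensorMor_pentagon (W X Y Z : Tcat k δ α) :
    tensorMor (eqToHom (congrArg (Tcat.mk (δ := δ) (α := α))
        (Nat.add_assoc W.strands X.strands Y.strands))) (𝟙 Z) ≫
      eqToHom (congrArg Tcat.mk (Nat.add_assoc W.strands (X.strands + Y.strands) Z.strands)) ≫
      tensorMor (𝟙 W) (eqToHom (congrArg (Tcat.mk (δ := δ) (α := α))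
        (Nat.add_assoc X.strands Y.strands Z.strands))) =
    eqToHom (congrArg Tcat.mk (Nat.add_assoc (W.strands + X.strands) Y.strands Z.strands)) ≫
      eqToHom (congrArg Tcat.mk
        (Nat.add_assoc W.strands X.strands (Y.strands + Z.strands))) := by
  rw [← eqToHom_refl Z rfl, ← eqToHom_refl W rfl, tensorMor_eqToHom, tensorMor_eqToHom]
  erw [eqToHom_trans, eqToHom_trans, eqToHom_trans]

theorem tensorMor_triangle (X Y : Tcat k δ α) :
    eqToHom (congrArg (Tcat.mk (δ := δ) (α := α)) (Nat.add_assoc X.strands 0 Y.strands)) ≫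
      tensorMor (𝟙 X) (eqToHom (congrArg (Tcat.mk (δ := δ) (α := α))
        (Nat.zero_add Y.strands))) =
    tensorMor (eqToHom (congrArg (Tcat.mk (δ := δ) (α := α)) (Nat.add_zero X.strands)))
      (𝟙 Y) := by
  rw [← eqToHom_refl X rfl, ← eqToHom_refl Y rfl, tensorMor_eqToHom, tensorMor_eqToHom]
  erw [eqToHom_trans]

/-- The strict monoidal structure: all associators and unitors are identities, that is, the
morphisms `eqToHom` of equalities of objects. -/
instance : MonoidalCategoryStruct (Tcat k δ α) where
  tensorObj X Y := ⟨X.strands + Y.strands⟩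
  tensorUnit := ⟨0⟩
  tensorHom f g := tensorMor f g
  whiskerLeft X _ _ f := tensorMor (𝟙 X) f
  whiskerRight f Y := tensorMor f (𝟙 Y)
  associator X Y Z := eqToIso (congrArg Tcat.mk (Nat.add_assoc X.strands Y.strands Z.strands))
  leftUnitor X := eqToIso (congrArg Tcat.mk (Nat.zero_add X.strands))
  rightUnitor X := eqToIso (congrArg Tcat.mk (Nat.add_zero X.strands))

instance : MonoidalCategory (Tcat k δ α) :=
  MonoidalCategory.ofTensorHom
    (id_tensorHom_id := fun X Y => Quotient.sound (Rel.id_tensor_id X.strands Y.strands))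
    (tensorHom_comp_tensorHom := by
      rintro _ _ _ _ _ _ ⟨f⟩ ⟨f'⟩ ⟨g⟩ ⟨g'⟩
      exact Quotient.sound (Rel.interchange f g f' g').symm)
    (associator_naturality := fun f g h => tensorMor_assoc f g h)
    (leftUnitor_naturality := fun f => one_tensorMor f)
    (rightUnitor_naturality := fun f => tensorMor_one f)
    (pentagon := fun W X Y Z => tensorMor_pentagon W X Y Z)
    (triangle := fun X Y => tensorMor_triangle X Y)

instance : MonoidalPreadditive (Tcat k δ α) where
  whiskerLeft_zero := by
    intro X Y Z
    have h : ∀ f g : Y ⟶ Z, X ◁ (f + g) = X ◁ f + X ◁ g := by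
      rintro ⟨f⟩ ⟨g⟩; exact Quotient.sound (Rel.tensor_add _ f g)
    simpa using h 0 0
  zero_whiskerRight := by
    intro X Y Z
    have h : ∀ f g : Y ⟶ Z, (f + g) ▷ X = f ▷ X + g ▷ X := by
      rintro ⟨f⟩ ⟨g⟩; exact Quotient.sound (Rel.add_tensor f g _)
    simpa using h 0 0
  whiskerLeft_add := by rintro X Y Z ⟨f⟩ ⟨g⟩; exact Quotient.sound (Rel.tensor_add _ f g)
  add_whiskerRight := by rintro X Y Z ⟨f⟩ ⟨g⟩; exact Quotient.sound (Rel.add_tensor f g _)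

instance : MonoidalLinear k (Tcat k δ α) where
  whiskerLeft_smul := by rintro X Y Z c ⟨f⟩; exact Quotient.sound (Rel.tensor_smul c _ f)
  smul_whiskerRight := by rintro c Y Z ⟨f⟩ X; exact Quotient.sound (Rel.smul_tensor c f _)

end Tcat

/-- A tensor ideal of a `k`-linear monoidal category: a family of subspaces of the hom-spaces,
closed under composition with arbitrary morphisms and under tensoring with identities on both
sides. -/
structure TensorIdeal (k : Type*) [CommRing k] (C : Type*) [Category C] [Preadditive C]
    [Linear k C] [MonoidalCategory C] where
  /-- the subspaces -/
  hom (X Y : C) : Submodule k (X ⟶ Y)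
  comp_mem {X Y Z : C} {f : X ⟶ Y} (hf : f ∈ hom X Y) (g : Y ⟶ Z) : f ≫ g ∈ hom X Z
  mem_comp {X Y Z : C} (g : Z ⟶ X) {f : X ⟶ Y} (hf : f ∈ hom X Y) : g ≫ f ∈ hom Z Y
  whiskerLeft_mem (Z : C) {X Y : C} {f : X ⟶ Y} (hf : f ∈ hom X Y) :
    Z ◁ f ∈ hom (Z ⊗ X) (Z ⊗ Y)
  whiskerRight_mem {X Y : C} {f : X ⟶ Y} (hf : f ∈ hom X Y) (Z : C) :
    f ▷ Z ∈ hom (X ⊗ Z) (Y ⊗ Z)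

namespace TensorIdeal

variable {k : Type*} [CommRing k] {C : Type*} [Category C] [Preadditive C] [Linear k C]
  [MonoidalCategory C] (I : TensorIdeal k C)

/-- The space of morphisms `X → Y` in the quotient category `C / I`. -/
abbrev QuotHom (X Y : C) := (X ⟶ Y) ⧸ I.hom X Y

/-- The quotient map from `C(X, Y)` onto `(C / I)(X, Y)`. -/
def toQuot {X Y : C} : (X ⟶ Y) →ₗ[k] I.QuotHom X Y := (I.hom X Y).mkQ

/-- The quotient category `C / I` is nontrivial: not all of its morphisms are zero. -/
def QuotNontrivial : Prop := ∃ X Y : C, ∃ f : X ⟶ Y, I.toQuot f ≠ 0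

end TensorIdeal

/-- The Jacobi identity for the trivalent vertex in the quotient by a tensor ideal. -/
def JacobiMod {k : Type u} [CommRing k] {δ α : k} (I : TensorIdeal k (Tcat k δ α)) : Prop :=
  I.toQuot (Tcat.of δ α Tm.dotcross) =
    I.toQuot (Tcat.of δ α Tm.Imor) - I.toQuot (Tcat.of δ α Tm.Hmor)

open Tm in
/-- The sixteen diagrams with two strands at the bottom and three at the top: the five planar trees,
the ten diagrams consisting of a trivalent vertex and a strand, and one nonplanar tree. -/
def diagrams (k : Type u) : Fin 16 → Tm k 2 3 := ![
  (split ⊗ᵗ split) ≫ᵗ (idn 1 ⊗ᵗ merge ⊗ᵗ idn 1),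
  merge ≫ᵗ split ≫ᵗ (split ⊗ᵗ idn 1),
  merge ≫ᵗ split ≫ᵗ (idn 1 ⊗ᵗ split),
  (split ⊗ᵗ idn 1) ≫ᵗ (idn 1 ⊗ᵗ merge) ≫ᵗ (idn 1 ⊗ᵗ split),
  (idn 1 ⊗ᵗ split) ≫ᵗ (merge ⊗ᵗ idn 1) ≫ᵗ (split ⊗ᵗ idn 1),
  cap ≫ᵗ cup ≫ᵗ (idn 1 ⊗ᵗ split),
  idn 1 ⊗ᵗ split,
  split ⊗ᵗ idn 1,
  cup ⊗ᵗ merge,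
  merge ⊗ᵗ cup,
  merge ≫ᵗ (cup ⊗ᵗ idn 1) ≫ᵗ (idn 1 ⊗ᵗ cross),
  (split ⊗ᵗ idn 1) ≫ᵗ (idn 1 ⊗ᵗ cross),
  (idn 1 ⊗ᵗ split) ≫ᵗ (cross ⊗ᵗ idn 1),
  cross ≫ᵗ (split ⊗ᵗ idn 1),
  cross ≫ᵗ (idn 1 ⊗ᵗ split),
  cross ≫ᵗ (split ⊗ᵗ split) ≫ᵗ (idn 1 ⊗ᵗ merge ⊗ᵗ idn 1)]

end Trivalent

/-!
The sixteen diagrams are shown to be independent by closing them up in sixteen ways and inverting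
the resulting Gram matrix.

Bending the two bottom strands to the top (`attach`, `bent`) turns the diagrams into elements of
`Inv I 5`, the space of diagrams with five free legs at the top, modulo the ideal. The elements of
`Inv I n` are manipulated with the operators `cr`, `mg`, `sp`, `cp`, `cu`, which attach a crossing,
a vertex, a cap or a cup to neighbouring legs. The relations of the presentation become identities
between these operators, and strict associativity is dealt with once and for all in `Eqv` and `op`.

The Jacobi identity evaluates every triangle as half a vertex (`mg_sp_succ_sp`, `mg_mg_cr_sp`), and
it expresses each tree with five legs in the six left-normed trees, which are `tree` with its legs
`1`, `2`, `3` permuted. The other ten diagrams `arc` consist of a strand and a vertex. The bent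
diagrams are an invertible linear combination (`bent_0`, …, `bent_15`) of these sixteen elements,
which are collected in `comb`.

In terms of `comb`, transposing neighbouring legs is given by explicit matrices (`cr_zero_comb`,
`cr_one_comb`, `cr_two_comb`). Closing two legs with a cap, or merging three legs into one, leaves a
multiple of the vertex `tri` with three legs, and the multiples are computed in `cp_zero_comb`,
`cp_three_comb` and `mg_mg_comb`. Closed cubic graphs with at most six vertices contain a short
cycle or are `K₃,₃`, so that these multiples only involve `δ`. Since the quotient is nontrivial and
`δ ≠ 0`, the vertex `tri` is not zero, and each vanishing multiple is a linear equation for the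
coefficients of a linear relation. As a representation of the symmetric group, the space with the
sixteen elements as a formal basis is a sum of two copies of an irreducible representation of
dimension six and one irreducible of dimension four, and for `δ ≠ 0` the Gram matrix degenerates on
either type only at `δ = 3`. Concretely, a cap together with six permuted tree functionals detects a
single coefficient, multiplied by `δ - 3` (`coeff_arc_zero_zero`, `coeff_arc_three_zero`). The
symmetries carry this to the coefficients of all `arc` diagrams (`coeff_arc`), and the remaining
equations for the six trees have constant coefficients (`coeff_tree`).
-/

namespace Trivalent

/-! ### Terms up to the relations, regardless of how the numbers of strands are written -/

section Eqv

variable {k : Type u} [CommRing k] {δ α : k}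

variable (δ α) in
/-- Two terms represent the same morphism after their numbers of strands are identified along
propositional equalities. With this relation the strict associativity of `⊗ᵗ` needs no casts. -/
def Eqv {m n m' n' : ℕ} (f : Tm k m n) (g : Tm k m' n') : Prop :=
  ∃ (hm : m = m') (hn : n = n'), Rel δ α m' n' (Tm.cast hm hn f) g

namespace Eqv

variable {l m n l' m' n' l'' m'' n'' : ℕ}

theorem of_rel {f g : Tm k m n} (h : Rel δ α m n f g) : Eqv δ α f g := ⟨rfl, rfl, h⟩

theorem refl (f : Tm k m n) : Eqv δ α f f := of_rel (Rel.refl f)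

theorem symm {f : Tm k m n} {g : Tm k m' n'} : Eqv δ α f g → Eqv δ α g f := by
  rintro ⟨rfl, rfl, h⟩
  exact of_rel (Rel.symm h)

theorem trans {f : Tm k m n} {g : Tm k m' n'} {e : Tm k m'' n''} :
    Eqv δ α f g → Eqv δ α g e → Eqv δ α f e := by
  rintro ⟨rfl, rfl, h⟩ ⟨rfl, rfl, h'⟩
  exact of_rel (Rel.trans h h')

theorem tensor {p q p' q' : ℕ} {f : Tm k m n} {g : Tm k p q} {f' : Tm k m' n'}
    {g' : Tm k p' q'} :
    Eqv δ α f f' → Eqv δ α g g' → Eqv δ α (f ⊗ᵗ g) (f' ⊗ᵗ g') := by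
  rintro ⟨rfl, rfl, h⟩ ⟨rfl, rfl, h'⟩
  exact of_rel (Rel.tensor_congr h h')

theorem assoc {p q : ℕ} (f : Tm k m n) (g : Tm k m' n') (h : Tm k p q) :
    Eqv δ α ((f ⊗ᵗ g) ⊗ᵗ h) (f ⊗ᵗ (g ⊗ᵗ h)) :=
  ⟨_, _, Rel.tensor_assoc f g h⟩

theorem idn_add (m n : ℕ) : Eqv δ α (Tm.idn (k := k) (m + n)) (Tm.idn m ⊗ᵗ Tm.idn n) :=
  of_rel (Rel.symm (Rel.id_tensor_id m n))

theorem tensor_idn_zero (f : Tm k m n) : Eqv δ α (f ⊗ᵗ Tm.idn 0) f :=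
  ⟨_, _, Rel.tensor_one f⟩

theorem interchange {f : Tm k l m} {g : Tm k m n} {f' : Tm k l' m'} {g' : Tm k m' n'} :
    Eqv δ α ((f ≫ᵗ g) ⊗ᵗ (f' ≫ᵗ g')) ((f ⊗ᵗ f') ≫ᵗ (g ⊗ᵗ g')) :=
  of_rel (Rel.interchange f g f' g')

theorem comp_idn {f : Tm k m n} : Eqv δ α (f ≫ᵗ Tm.idn n) f := of_rel (Rel.comp_id f)

theorem idn_comp {f : Tm k m n} : Eqv δ α (Tm.idn m ≫ᵗ f) f := of_rel (Rel.id_comp f)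

theorem interchange_idn {f : Tm k l m} {g : Tm k l' m'} :
    Eqv δ α ((f ⊗ᵗ Tm.idn l') ≫ᵗ (Tm.idn m ⊗ᵗ g)) (f ⊗ᵗ g) :=
  interchange.symm.trans (comp_idn.tensor idn_comp)

theorem interchange_idn' {f : Tm k l m} {g : Tm k l' m'} :
    Eqv δ α ((Tm.idn l ⊗ᵗ g) ≫ᵗ (f ⊗ᵗ Tm.idn m')) (f ⊗ᵗ g) :=
  interchange.symm.trans (idn_comp.tensor comp_idn)

end Eqv

/-- The term `f` with `i` strands added on its left and `j` strands added on its right. -/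
def layer (i : ℕ) {m n : ℕ} (f : Tm k m n) (j : ℕ) : Tm k (i + m + j) (i + n + j) :=
  (Tm.idn i ⊗ᵗ f) ⊗ᵗ Tm.idn j

namespace Eqv

variable {l m n l' m' n' : ℕ}

theorem layer_congr {i j : ℕ} {f : Tm k m n} {g : Tm k m' n'} (h : Eqv δ α f g) :
    Eqv δ α (layer i f j) (layer i g j) :=
  ((refl _).tensor h).tensor (refl _)

theorem layer_comp (i j : ℕ) (f : Tm k l m) (g : Tm k m n) :
    Eqv δ α (layer i (f ≫ᵗ g) j) (layer i f j ≫ᵗ layer i g j) :=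
  (((idn_comp (f := Tm.idn i)).symm.tensor (refl _)).trans interchange |>.tensor
    (idn_comp (f := Tm.idn j)).symm).trans interchange

theorem layer_layer (i i' j j' : ℕ) (f : Tm k m n) :
    Eqv δ α (layer i (layer i' f j') j) (layer (i + i') f (j' + j)) := by
  unfold layer
  refine ((assoc _ _ _).symm.tensor (refl _)).trans ((assoc _ _ _).trans ?_)
  exact ((assoc _ _ _).symm.trans ((idn_add _ _).symm.tensor (refl _))).tensor
    (idn_add _ _).symm

theorem tensor_idn_layer (f : Tm k m n) (j : ℕ) : Eqv δ α (f ⊗ᵗ Tm.idn j) (layer 0 f j) :=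
  Eqv.tensor (Eqv.symm ⟨_, _, Rel.one_tensor f⟩) (refl _)

theorem idn_tensor_layer (f : Tm k m n) (i : ℕ) : Eqv δ α (Tm.idn i ⊗ᵗ f) (layer i f 0) :=
  (tensor_idn_zero _).symm

theorem layer_idn (i m j : ℕ) :
    Eqv δ α (layer i (Tm.idn (k := k) m) j) (Tm.idn (i + m + j)) :=
  (((idn_add _ _).symm.tensor (refl _))).trans (idn_add _ _).symm

end Eqv

end Eqv

/-! ### Elements with `n` free legs, and the operators that attach a term to some of the legs -/

section Inv

variable {k : Type u} [CommRing k] {δ α : k}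

/-- The space of morphisms from the unit object to the `n`-th tensor power in the quotient by a
tensor ideal: diagrams with `n` free legs, all of them at the top. -/
def Inv (I : TensorIdeal k (Tcat k δ α)) (n : ℕ) : Type u :=
  I.QuotHom (⟨0⟩ : Tcat k δ α) ⟨n⟩

instance (I : TensorIdeal k (Tcat k δ α)) (n : ℕ) : AddCommGroup (Inv I n) :=
  inferInstanceAs (AddCommGroup (I.QuotHom (⟨0⟩ : Tcat k δ α) ⟨n⟩))

instance (I : TensorIdeal k (Tcat k δ α)) (n : ℕ) : Module k (Inv I n) :=
  inferInstanceAs (Module k (I.QuotHom (⟨0⟩ : Tcat k δ α) ⟨n⟩))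

variable {I : TensorIdeal k (Tcat k δ α)}

variable (I) in
/-- Composition with a term, on diagrams with free legs. -/
def act {m n : ℕ} (f : Tm k m n) : Inv I m →ₗ[k] Inv I n :=
  Submodule.mapQ (I.hom ⟨0⟩ ⟨m⟩) (I.hom ⟨0⟩ ⟨n⟩)
    (Linear.rightComp k (⟨0⟩ : Tcat k δ α) (Tcat.of δ α f)) fun _ h => I.comp_mem h _

theorem act_mk {m n : ℕ} (f : Tm k m n) (g : (⟨0⟩ : Tcat k δ α) ⟶ ⟨m⟩) :
    act I f (I.toQuot g) = (I.toQuot (g ≫ Tcat.of δ α f) : Inv I n) := rfl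

theorem toQuot_surjective {n : ℕ} (v : Inv I n) :
    ∃ g : (⟨0⟩ : Tcat k δ α) ⟶ ⟨n⟩, I.toQuot g = v :=
  Submodule.mkQ_surjective _ v

theorem act_eqv {m n : ℕ} {f g : Tm k m n} (h : Eqv δ α f g) : act I f = act I g := by
  obtain ⟨_, _, h⟩ := h
  ext v
  obtain ⟨v, rfl⟩ := toQuot_surjective v
  exact congrArg (fun w => (I.toQuot (v ≫ w) : Inv I n)) (Tcat.of_eq h)

theorem act_comp {l m n : ℕ} (f : Tm k l m) (g : Tm k m n) (v : Inv I l) :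
    act I (f ≫ᵗ g) v = act I g (act I f v) := by
  obtain ⟨v, rfl⟩ := toQuot_surjective v
  rw [act_mk, act_mk, act_mk, Category.assoc]
  rfl

theorem act_idn {n : ℕ} (v : Inv I n) : act I (Tm.idn n) v = v := by
  obtain ⟨v, rfl⟩ := toQuot_surjective v
  exact (act_mk _ _).trans (congrArg _ (Category.comp_id v))

theorem act_add {m n : ℕ} (f g : Tm k m n) (v : Inv I m) :
    act I (Tm.add f g) v = act I f v + act I g v := by
  obtain ⟨v, rfl⟩ := toQuot_surjective v
  have h : v ≫ Tcat.of δ α (Tm.add f g) = v ≫ Tcat.of δ α f + v ≫ Tcat.of δ α g :=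
    Preadditive.comp_add _ _ _ v (Tcat.of δ α f) (Tcat.of δ α g)
  exact (congrArg I.toQuot h).trans (map_add _ _ _)

theorem act_smul {m n : ℕ} (c : k) (f : Tm k m n) (v : Inv I m) :
    act I (Tm.smul c f) v = c • act I f v := by
  obtain ⟨v, rfl⟩ := toQuot_surjective v
  have h : v ≫ Tcat.of δ α (Tm.smul c f) = c • (v ≫ Tcat.of δ α f) :=
    Linear.comp_smul _ _ _ v c (Tcat.of δ α f)
  exact (congrArg I.toQuot h).trans (map_smul _ _ _)

variable (I) in
/-- `op I N N' i f` attaches the `m` bottom strands of `f : Tm k m n` to the legs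
`i, i + 1, …, i + m - 1` of a diagram with `N` legs, which leaves `N' = N - m + n` legs. For all
other values of `N'`, and if there are too few legs, it is zero. -/
def op (N N' i : ℕ) {m n : ℕ} (f : Tm k m n) : Inv I N →ₗ[k] Inv I N' :=
  if h : i + m ≤ N ∧ N' + m = N + n then
    act I (Tm.cast (by omega) (by omega) (layer i f (N - i - m)))
  else 0

theorem op_eq_act {N N' i j m n : ℕ} {f : Tm k m n} {F : Tm k N N'}
    (h : Eqv δ α (layer i f j) F) : op I N N' i f = act I F := by
  obtain ⟨rfl, rfl, h⟩ := h
  rw [← act_eqv (Eqv.of_rel h), op, dif_pos (by omega)]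
  have e : i + m + j - i - m = j := by omega
  generalize_proofs h1 h2
  generalize i + m + j - i - m = j' at *
  subst e
  rfl

theorem op_layer (i j : ℕ) {m n : ℕ} (f : Tm k m n) :
    op I (i + m + j) (i + n + j) i f = act I (layer i f j) :=
  op_eq_act (Eqv.refl _)

theorem op_congr {N N' i m n : ℕ} {f g : Tm k m n} (h : Rel δ α m n f g) :
    op I N N' i f = op I N N' i g := by
  unfold op
  split_ifs with hN
  · apply act_eqv
    refine Eqv.trans ?_ (Eqv.trans (Eqv.layer_congr (i := i) (j := N - i - m) (Eqv.of_rel h)) ?_)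
    · exact Eqv.symm ⟨by omega, by omega, Rel.refl _⟩
    · exact ⟨by omega, by omega, Rel.refl _⟩
  · rfl

theorem op_comp {N N' N'' i l m n : ℕ} (f : Tm k l m) (g : Tm k m n) (v : Inv I N)
    (h : i + l ≤ N) (h' : N' + l = N + m) (h'' : N'' + l = N + n) :
    op I N N'' i (f ≫ᵗ g) v = op I N' N'' i g (op I N N' i f v) := by
  obtain ⟨j, rfl⟩ := Nat.exists_eq_add_of_le h
  obtain rfl : N' = i + m + j := by omega
  obtain rfl : N'' = i + n + j := by omega
  rw [op_layer, op_layer, op_layer, ← act_comp, act_eqv (Eqv.layer_comp i j f g)]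

theorem op_idn {N i m : ℕ} (v : Inv I N) (h : i + m ≤ N) : op I N N i (Tm.idn m) v = v := by
  obtain ⟨j, rfl⟩ := Nat.exists_eq_add_of_le h
  rw [op_layer, act_eqv (Eqv.layer_idn i m j), act_idn]

theorem op_add {N N' i m n : ℕ} (f g : Tm k m n) (v : Inv I N)
    (h : i + m ≤ N) (h' : N' + m = N + n) :
    op I N N' i (Tm.add f g) v = op I N N' i f v + op I N N' i g v := by
  obtain ⟨j, rfl⟩ := Nat.exists_eq_add_of_le h
  obtain rfl : N' = i + n + j := by omega
  rw [op_layer, op_layer, op_layer, ← act_add]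
  refine DFunLike.congr_fun (act_eqv (Eqv.of_rel ?_)) v
  exact (Rel.tensor_congr (Rel.tensor_add _ _ _) (Rel.refl _)).trans (Rel.add_tensor _ _ _)

theorem op_smul {N N' i m n : ℕ} (c : k) (f : Tm k m n) (v : Inv I N)
    (h : i + m ≤ N) (h' : N' + m = N + n) :
    op I N N' i (Tm.smul c f) v = c • op I N N' i f v := by
  obtain ⟨j, rfl⟩ := Nat.exists_eq_add_of_le h
  obtain rfl : N' = i + n + j := by omega
  rw [op_layer, op_layer, ← act_smul]
  refine DFunLike.congr_fun (act_eqv (Eqv.of_rel ?_)) v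
  exact (Rel.tensor_congr (Rel.tensor_smul _ _ _) (Rel.refl _)).trans (Rel.smul_tensor _ _ _)

/-- Strands that a term leaves alone may be counted as part of its surroundings. -/
theorem op_layer_term {N N' i m n a b : ℕ} (f : Tm k m n) (h : i + (a + m + b) ≤ N)
    (h' : N' + m = N + n) :
    op I N N' i (layer a f b) = op I N N' (i + a) f := by
  obtain ⟨j, rfl⟩ := Nat.exists_eq_add_of_le h
  obtain rfl : N' = i + (a + n + b) + j := by omega
  rw [op_layer]
  exact (op_eq_act (Eqv.layer_layer i a j b f).symm).symm

theorem op_congr_eqv {N N' i m n m' n' : ℕ} {f : Tm k m n} {g : Tm k m' n'} (h : Eqv δ α f g) :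
    op I N N' i f = op I N N' i g := by
  obtain ⟨rfl, rfl, h⟩ := h
  exact op_congr h

theorem op_idn_tensor {N N' i m n a : ℕ} (f : Tm k m n) (h : i + a + m ≤ N)
    (h' : N' + m = N + n) :
    op I N N' i (Tm.idn a ⊗ᵗ f) = op I N N' (i + a) f := by
  rw [op_congr_eqv (Eqv.idn_tensor_layer f a), op_layer_term _ (by omega) h']

theorem op_tensor_idn {N N' i m n a : ℕ} (f : Tm k m n) (h : i + m + a ≤ N)
    (h' : N' + m = N + n) :
    op I N N' i (f ⊗ᵗ Tm.idn a) = op I N N' i f := by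
  rw [op_congr_eqv (Eqv.tensor_idn_layer f a), op_layer_term _ (by omega) h', Nat.add_zero]

theorem op_tensor {N N' N'' i m n m' n' : ℕ} (f : Tm k m n) (g : Tm k m' n') (v : Inv I N)
    (h : i + m + m' ≤ N) (h' : N' + m = N + n) (h'' : N'' + m' = N' + n') :
    op I N N'' i (f ⊗ᵗ g) v = op I N' N'' (i + n) g (op I N N' i f v) := by
  rw [op_congr_eqv (Eqv.interchange_idn (f := f) (g := g)).symm,
    op_comp (N' := N') _ _ _ (by omega) (by omega) (by omega), op_tensor_idn _ (by omega) h',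
    op_idn_tensor _ (by omega) h'']

theorem op_tensor' {N N' N'' i m n m' n' : ℕ} (f : Tm k m n) (g : Tm k m' n') (v : Inv I N)
    (h : i + m + m' ≤ N) (h' : N' + m' = N + n') (h'' : N'' + m = N' + n) :
    op I N N'' i (f ⊗ᵗ g) v = op I N' N'' i f (op I N N' (i + m) g v) := by
  rw [op_congr_eqv (Eqv.interchange_idn' (f := f) (g := g)).symm,
    op_comp (N' := N') _ _ _ (by omega) (by omega) (by omega),
    op_idn_tensor _ (by omega) h', op_tensor_idn _ (by omega) h'']

/-- Attaching terms to disjoint sets of legs can be done in either order. Here `f` is attached to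
the left of `g`; the position of `g` is `j` before and `j'` after `f` has been attached. -/
theorem op_op_comm {N N₁ N₂ N' i j j' m n m' n' : ℕ} (f : Tm k m n) (g : Tm k m' n')
    (v : Inv I N) (h : i + m ≤ j) (hj : j + m' ≤ N) (hj' : j' + m = j + n)
    (h₁ : N₁ + m = N + n) (h₂ : N₂ + m' = N + n') (h' : N' + m' = N₁ + n') :
    op I N₁ N' j' g (op I N N₁ i f v) = op I N₂ N' i f (op I N N₂ j g v) := by
  obtain ⟨a, rfl⟩ := Nat.exists_eq_add_of_le h
  obtain rfl : j' = i + n + a := by omega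
  rw [← op_idn_tensor _ (by omega) (by omega), ← op_idn_tensor (i := i + m) _ (by omega) (by omega),
    ← op_tensor _ _ _ (by omega) h₁ (by omega), ← op_tensor' _ _ _ (by omega) (by omega) (by omega)]

theorem layer_mem {m n i j : ℕ} {f g : Tm k m n}
    (h : Tcat.of δ α f - Tcat.of δ α g ∈ I.hom ⟨m⟩ ⟨n⟩) :
    Tcat.of δ α (layer i f j) - Tcat.of δ α (layer i g j) ∈ I.hom ⟨i + m + j⟩ ⟨i + n + j⟩ := by
  have := I.whiskerRight_mem (I.whiskerLeft_mem (⟨i⟩ : Tcat k δ α) h) (⟨j⟩ : Tcat k δ α)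
  have h₁ := (tensorLeft (⟨i⟩ : Tcat k δ α)).map_sub (f := Tcat.of δ α f) (g := Tcat.of δ α g)
  have h₂ := (tensorRight (⟨j⟩ : Tcat k δ α)).map_sub
    (f := (⟨i⟩ : Tcat k δ α) ◁ Tcat.of δ α f) (g := (⟨i⟩ : Tcat k δ α) ◁ Tcat.of δ α g)
  exact ((congrArg (· ▷ (⟨j⟩ : Tcat k δ α)) h₁).trans h₂) ▸ this

/-- Relations that hold only modulo the tensor ideal, such as the Jacobi identity, may be applied
to any legs of a diagram. -/
theorem op_congr_toQuot {N N' i m n : ℕ} {f g : Tm k m n}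
    (h : I.toQuot (Tcat.of δ α f) = I.toQuot (Tcat.of δ α g)) (hN : i + m ≤ N)
    (hN' : N' + m = N + n) : op I N N' i f = op I N N' i g := by
  obtain ⟨j, rfl⟩ := Nat.exists_eq_add_of_le hN
  obtain rfl : N' = i + n + j := by omega
  rw [op_layer, op_layer]
  ext v
  obtain ⟨v, rfl⟩ := toQuot_surjective v
  refine (Submodule.Quotient.eq _).mpr ?_
  have := I.mem_comp v (layer_mem (i := i) (j := j) ((Submodule.Quotient.eq _).mp h))
  rwa [Preadditive.comp_sub] at this

variable (I) in
/-- Attaching a morphism of the quotient category to the legs of a fixed diagram `g`, with `i` legs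
left of it and `j` legs right of it, as a linear map in the attached morphism. -/
def attach {m n : ℕ} (i j : ℕ) (g : (⟨0⟩ : Tcat k δ α) ⟶ ⟨i + m + j⟩) :
    I.QuotHom (⟨m⟩ : Tcat k δ α) ⟨n⟩ →ₗ[k] Inv I (i + n + j) :=
  (I.hom (⟨m⟩ : Tcat k δ α) ⟨n⟩).liftQ
    { toFun := fun f => I.toQuot (g ≫ ((⟨i⟩ : Tcat k δ α) ◁ f) ▷ (⟨j⟩ : Tcat k δ α))
      map_add' := fun f f' => by
        rw [MonoidalPreadditive.whiskerLeft_add, MonoidalPreadditive.add_whiskerRight,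
          Preadditive.comp_add]
        exact map_add _ _ _
      map_smul' := fun c f => by
        rw [MonoidalLinear.whiskerLeft_smul, MonoidalLinear.smul_whiskerRight, Linear.comp_smul]
        exact map_smul _ _ _ }
    fun _ hf => (Submodule.Quotient.mk_eq_zero _).mpr
      (I.mem_comp g (I.whiskerRight_mem (I.whiskerLeft_mem _ hf) _))

theorem attach_of {m n : ℕ} (i j : ℕ) (g : (⟨0⟩ : Tcat k δ α) ⟶ ⟨i + m + j⟩) (f : Tm k m n) :
    attach I i j g (I.toQuot (Tcat.of δ α f)) =
      op I (i + m + j) (i + n + j) i f (I.toQuot g) := by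
  rw [op_layer]
  rfl

end Inv

/-! ### The operators of the generators and their relations -/

section Gen

variable {k : Type u} [Field k] {δ : k} {I : TensorIdeal k (Tcat k δ 1)} {n : ℕ}

/-- Cross the legs `i` and `i + 1`. -/
def cr (i : ℕ) : Inv I n →ₗ[k] Inv I n := op I n n i Tm.cross

/-- Merge the legs `i` and `i + 1`. -/
def mg (i : ℕ) : Inv I (n + 1) →ₗ[k] Inv I n := op I (n + 1) n i Tm.merge

/-- Split the leg `i`. -/
def sp (i : ℕ) : Inv I n →ₗ[k] Inv I (n + 1) := op I n (n + 1) i Tm.split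

/-- Connect the legs `i` and `i + 1` by a cap. -/
def cp (i : ℕ) : Inv I (n + 2) →ₗ[k] Inv I n := op I (n + 2) n i Tm.cap

/-- Insert a cup, whose ends become the legs `i` and `i + 1`. -/
def cu (i : ℕ) : Inv I n →ₗ[k] Inv I (n + 2) := op I n (n + 2) i Tm.cup

/-! Operators on disjoint sets of legs commute, up to the change of positions. -/

section Far

variable {i j : ℕ}

theorem cr_cr_far (v : Inv I n) (h : i + 2 ≤ j) (hj : j + 2 ≤ n) :
    cr j (cr i v) = cr i (cr j v) :=
  op_op_comm _ _ _ (by omega) (by omega) (by omega) (by omega) (by omega) (by omega)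

theorem cu_cu_same (v : Inv I n) (h : i ≤ n) : cu (i + 2) (cu i v) = cu i (cu i v) :=
  op_op_comm _ _ _ (by omega) (by omega) (by omega) (by omega) (by omega) (by omega)

theorem cr_cu_right (v : Inv I n) (h : i ≤ j) (hj : j + 2 ≤ n) :
    cr (j + 2) (cu i v) = cu i (cr j v) :=
  op_op_comm _ _ _ (by omega) (by omega) (by omega) (by omega) (by omega) (by omega)

theorem cr_cu_left (v : Inv I n) (h : i + 2 ≤ j) (hj : j ≤ n) : cr i (cu j v) = cu j (cr i v) :=
  (op_op_comm _ _ _ (by omega) (by omega) (by omega) (by omega) (by omega) (by omega)).symm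

theorem cp_cu_right (v : Inv I (n + 2)) (h : i ≤ j) (hj : j ≤ n) :
    cp (j + 2) (cu i v) = cu i (cp j v) :=
  op_op_comm _ _ _ (by omega) (by omega) (by omega) (by omega) (by omega) (by omega)

theorem cp_cu_left (v : Inv I (n + 2)) (h : i ≤ j) (hj : j ≤ n) :
    cp i (cu (j + 2) v) = cu j (cp i v) :=
  (op_op_comm _ _ _ (by omega) (by omega) (by omega) (by omega) (by omega) (by omega)).symm

theorem cp_mg_right (v : Inv I (n + 3)) (h : i + 1 ≤ j) (hj : j ≤ n) :
    cp j (mg i v) = mg i (cp (j + 1) v) :=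
  op_op_comm _ _ _ (by omega) (by omega) (by omega) (by omega) (by omega) (by omega)

theorem cr_mg_right (v : Inv I (n + 1)) (h : i + 1 ≤ j) (hj : j + 2 ≤ n) :
    cr j (mg i v) = mg i (cr (j + 1) v) :=
  op_op_comm _ _ _ (by omega) (by omega) (by omega) (by omega) (by omega) (by omega)

theorem sp_cu_left (v : Inv I n) (h : i + 1 ≤ j) (hj : j ≤ n) :
    sp i (cu j v) = cu (j + 1) (sp i v) :=
  (op_op_comm _ _ _ (by omega) (by omega) (by omega) (by omega) (by omega) (by omega)).symm

theorem sp_mg_right (v : Inv I (n + 1)) (h : i + 1 ≤ j) (hj : j + 1 ≤ n) :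
    sp j (mg i v) = mg i (sp (j + 1) v) :=
  op_op_comm _ _ _ (by omega) (by omega) (by omega) (by omega) (by omega) (by omega)

theorem sp_sp_far (v : Inv I n) (h : i + 1 ≤ j) (hj : j + 1 ≤ n) :
    sp (j + 1) (sp i v) = sp i (sp j v) :=
  op_op_comm _ _ _ (by omega) (by omega) (by omega) (by omega) (by omega) (by omega)

theorem cr_sp_right (v : Inv I n) (h : i + 1 ≤ j) (hj : j + 2 ≤ n) :
    cr (j + 1) (sp i v) = sp i (cr j v) :=
  op_op_comm _ _ _ (by omega) (by omega) (by omega) (by omega) (by omega) (by omega)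

theorem cp_sp_right (v : Inv I (n + 2)) (h : i + 1 ≤ j) (hj : j ≤ n) :
    cp (j + 1) (sp i v) = sp i (cp j v) :=
  op_op_comm _ _ _ (by omega) (by omega) (by omega) (by omega) (by omega) (by omega)

theorem cp_cr_left (v : Inv I (n + 2)) (h : i ≤ j) (hj : j + 2 ≤ n) :
    cp i (cr (j + 2) v) = cr j (cp i v) :=
  (op_op_comm _ _ _ (by omega) (by omega) (by omega) (by omega) (by omega) (by omega)).symm

theorem cp_cr_right (v : Inv I (n + 2)) (h : i + 2 ≤ j) (hj : j ≤ n) :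
    cp j (cr i v) = cr i (cp j v) :=
  op_op_comm _ _ _ (by omega) (by omega) (by omega) (by omega) (by omega) (by omega)

theorem mg_cu_left (v : Inv I (n + 1)) (h : i + 1 ≤ j) (hj : j ≤ n) :
    mg i (cu (j + 1) v) = cu j (mg i v) :=
  (op_op_comm _ _ _ (by omega) (by omega) (by omega) (by omega) (by omega) (by omega)).symm

theorem mg_cr_left (v : Inv I (n + 1)) (h : i + 2 ≤ j) (hj : j + 1 ≤ n) :
    mg j (cr i v) = cr i (mg j v) :=
  op_op_comm _ _ _ (by omega) (by omega) (by omega) (by omega) (by omega) (by omega)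

theorem sp_cr_left (v : Inv I n) (h : i + 2 ≤ j) (hj : j + 1 ≤ n) :
    sp j (cr i v) = cr i (sp j v) :=
  op_op_comm _ _ _ (by omega) (by omega) (by omega) (by omega) (by omega) (by omega)

theorem sp_mg_left (v : Inv I (n + 1)) (h : i + 1 ≤ j) (hj : j + 1 ≤ n) :
    sp i (mg j v) = mg (j + 1) (sp i v) :=
  (op_op_comm _ _ _ (by omega) (by omega) (by omega) (by omega) (by omega) (by omega)).symm

theorem sp_cu_right (v : Inv I n) (h : i ≤ j) (hj : j + 1 ≤ n) :
    sp (j + 2) (cu i v) = cu i (sp j v) :=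
  op_op_comm _ _ _ (by omega) (by omega) (by omega) (by omega) (by omega) (by omega)

end Far

variable (i : ℕ)

/-! The relations of the presentation, read as relations between operators. -/

theorem cp_cu_succ (v : Inv I n) (h : i + 1 ≤ n) : cp i (cu (i + 1) v) = v := by
  have := DFunLike.congr_fun (op_congr (I := I) (N := n) (N' := n) (i := i) Rel.zigzag_left) v
  rwa [op_comp (N' := n + 2) _ _ _ (by omega) (by omega) (by omega),
    op_idn_tensor _ (by omega) (by omega), op_tensor_idn _ (by omega) (by omega),
    op_idn _ (by omega)] at this

theorem cp_succ_cu (v : Inv I n) (h : i + 1 ≤ n) : cp (i + 1) (cu i v) = v := by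
  have := DFunLike.congr_fun (op_congr (I := I) (N := n) (N' := n) (i := i) Rel.zigzag_right) v
  rwa [op_comp (N' := n + 2) _ _ _ (by omega) (by omega) (by omega),
    op_idn_tensor _ (by omega) (by omega), op_tensor_idn _ (by omega) (by omega),
    op_idn _ (by omega)] at this

theorem sp_eq_mg_succ_cu (v : Inv I n) (h : i + 1 ≤ n) : sp i v = mg (i + 1) (cu i v) := by
  unfold sp Tm.split
  rw [op_comp (N' := n + 2) _ _ _ (by omega) (by omega) (by omega),
    op_idn_tensor _ (by omega) (by omega), op_tensor_idn _ (by omega) (by omega)]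
  rfl

theorem sp_eq_mg_cu_succ (v : Inv I n) (h : i + 1 ≤ n) : sp i v = mg i (cu (i + 1) v) := by
  unfold sp
  rw [op_congr Rel.rotate, op_comp (N' := n + 2) _ _ _ (by omega) (by omega) (by omega),
    op_idn_tensor _ (by omega) (by omega), op_tensor_idn _ (by omega) (by omega)]
  rfl

theorem cp_succ_cr (v : Inv I (n + 2)) (h : i + 1 ≤ n) :
    cp (i + 1) (cr i v) = cp i (cr (i + 1) v) := by
  have := DFunLike.congr_fun (op_congr (I := I) (N := n + 2) (N' := n) (i := i) Rel.cap_slide) v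
  rwa [op_comp (N' := n + 2) _ _ _ (by omega) (by omega) (by omega),
    op_comp (N' := n + 2) _ _ _ (by omega) (by omega) (by omega),
    op_idn_tensor _ (by omega) (by omega), op_tensor_idn _ (by omega) (by omega),
    op_idn_tensor _ (by omega) (by omega), op_tensor_idn _ (by omega) (by omega)] at this

theorem cr_cr (v : Inv I n) (h : i + 2 ≤ n) : cr i (cr i v) = v := by
  have := DFunLike.congr_fun (op_congr (I := I) (N := n) (N' := n) (i := i) Rel.cross_cross) v
  rwa [op_comp (N' := n) _ _ _ (by omega) (by omega) (by omega), op_idn _ (by omega)] at this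

theorem cr_braid (v : Inv I n) (h : i + 3 ≤ n) :
    cr i (cr (i + 1) (cr i v)) = cr (i + 1) (cr i (cr (i + 1) v)) := by
  have := DFunLike.congr_fun (op_congr (I := I) (N := n) (N' := n) (i := i) Rel.braid) v
  rwa [op_comp (N' := n) _ _ _ (by omega) (by omega) (by omega),
    op_comp (N' := n) _ _ _ (by omega) (by omega) (by omega),
    op_comp (N' := n) _ _ _ (by omega) (by omega) (by omega),
    op_comp (N' := n) _ _ _ (by omega) (by omega) (by omega),
    op_idn_tensor _ (by omega) (by omega), op_tensor_idn _ (by omega) (by omega)] at this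

theorem cr_mg (v : Inv I (n + 1)) (h : i + 2 ≤ n) :
    cr i (mg i v) = mg (i + 1) (cr i (cr (i + 1) v)) := by
  have := DFunLike.congr_fun (op_congr (I := I) (N := n + 1) (N' := n) (i := i) Rel.merge_slide) v
  rw [op_comp (N' := n + 1) _ _ _ (by omega) (by omega) (by omega),
    op_comp (N' := n + 1) _ _ _ (by omega) (by omega) (by omega),
    op_comp (N' := n) _ _ _ (by omega) (by omega) (by omega),
    op_idn_tensor _ (by omega) (by omega), op_tensor_idn _ (by omega) (by omega),
    op_idn_tensor _ (by omega) (by omega), op_tensor_idn _ (by omega) (by omega)] at this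
  exact this.symm

theorem sp_cr (v : Inv I n) (h : i + 2 ≤ n) :
    sp i (cr i v) = cr (i + 1) (cr i (sp (i + 1) v)) := by
  have := DFunLike.congr_fun (op_congr (I := I) (N := n) (N' := n + 1) (i := i) Rel.split_slide) v
  rw [op_comp (N' := n + 1) _ _ _ (by omega) (by omega) (by omega),
    op_comp (N' := n + 1) _ _ _ (by omega) (by omega) (by omega),
    op_comp (N' := n) _ _ _ (by omega) (by omega) (by omega),
    op_idn_tensor _ (by omega) (by omega), op_tensor_idn _ (by omega) (by omega),
    op_idn_tensor _ (by omega) (by omega), op_tensor_idn _ (by omega) (by omega)] at this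
  exact this.symm

theorem cp_cr (v : Inv I (n + 2)) (h : i ≤ n) : cp i (cr i v) = cp i v := by
  have := DFunLike.congr_fun (op_congr (I := I) (N := n + 2) (N' := n) (i := i) Rel.cross_cap) v
  rwa [op_comp (N' := n + 2) _ _ _ (by omega) (by omega) (by omega)] at this

theorem mg_cr (v : Inv I (n + 1)) (h : i + 1 ≤ n) : mg i (cr i v) = -mg i v := by
  have := DFunLike.congr_fun (op_congr (I := I) (N := n + 1) (N' := n) (i := i) Rel.cross_merge) v
  rwa [op_comp (N' := n + 1) _ _ _ (by omega) (by omega) (by omega),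
    op_smul _ _ _ (by omega) (by omega), neg_one_smul] at this

theorem mg_sp (v : Inv I n) (h : i + 1 ≤ n) : mg i (sp i v) = v := by
  have := DFunLike.congr_fun (op_congr (I := I) (N := n) (N' := n) (i := i) Rel.bigon) v
  rwa [op_comp (N' := n + 1) _ _ _ (by omega) (by omega) (by omega),
    op_smul _ _ _ (by omega) (by omega), one_smul, op_idn _ (by omega)] at this

theorem cp_cu (v : Inv I n) (h : i ≤ n) : cp i (cu i v) = δ • v := by
  have := DFunLike.congr_fun (op_congr (I := I) (N := n) (N' := n) (i := i) Rel.circle) v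
  rwa [op_comp (N' := n + 2) _ _ _ (by omega) (by omega) (by omega),
    op_smul _ _ _ (by omega) (by omega), op_idn _ (by omega)] at this

/-! Consequences that hold without the Jacobi identity. -/

theorem cr_cu_slide (v : Inv I n) (h : i + 1 ≤ n) : cr i (cu (i + 1) v) = cr (i + 1) (cu i v) := by
  -- both sides come from the two cups `(i, i + 1)` and `(i + 3, i + 4)`: a cap joins their inner
  -- ends after passing the leg `i + 2` between them on one side or on the other
  have h1 : cu i (cu (i + 1) v) = cu (i + 3) (cu i v) :=
    (op_op_comm _ _ _ (by omega) (by omega) (by omega) (by omega) (by omega) (by omega)).symm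
  have h2 := cp_succ_cr (i + 1) (cu i (cu (i + 1) v)) (by omega)
  rw [cr_cu_right (i := i) (j := i) _ le_rfl (by omega), cp_succ_cu _ _ (by omega), h1,
    cr_cu_left _ (by omega) (by omega), cp_cu_succ _ _ (by omega)] at h2
  exact h2.symm

/-- The cup is symmetric because the cap is. -/
theorem cr_cu (v : Inv I n) (h : i ≤ n) : cr i (cu i v) = cu i v := by
  -- a cap that joins one end each of two cups leaves a cup; the two ways of letting the free end of
  -- the first cup pass this cap give the cup with and without a crossing
  have h1 := cp_succ_cr i (cu i (cu i v)) (by omega)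
  rwa [← cr_cu_slide _ _ (by omega), cp_cr _ _ (by omega), cp_cu_succ _ _ (by omega),
    ← cu_cu_same _ h, cr_cu_left _ (by omega) (by omega), cp_cu_succ _ _ (by omega)] at h1

theorem cp_succ_sp (v : Inv I (n + 1)) (h : i + 1 ≤ n) : cp (i + 1) (sp i v) = mg i v := by
  rw [sp_eq_mg_cu_succ _ _ (by omega), cp_mg_right _ (by omega) (by omega),
    cp_succ_cu _ _ (by omega)]

/-- The vertex with three legs at the top does not depend on which end of the cup is split. -/
theorem sp_succ_cu (v : Inv I n) (h : i ≤ n) : sp (i + 1) (cu i v) = sp i (cu i v) := by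
  rw [sp_eq_mg_cu_succ _ _ (by omega), sp_eq_mg_succ_cu i _ (by omega), cu_cu_same _ h]

/-- The mirror image of `cr_mg`. -/
theorem cr_mg_succ (v : Inv I (n + 1)) (h : i + 2 ≤ n) :
    cr i (mg (i + 1) v) = mg i (cr (i + 1) (cr i v)) := by
  have := cr_mg i (cr (i + 1) (cr i v)) h
  rw [cr_cr _ _ (by omega), cr_cr _ _ (by omega)] at this
  rw [← this, cr_cr _ _ h]

/-- The split vertex is skew-symmetric: it is the merge vertex with one leg bent, and a crossing of
its two top strands can be pulled through the vertex and the cup. -/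
theorem cr_sp (v : Inv I n) (h : i + 1 ≤ n) : cr i (sp i v) = -sp i v := by
  rw [sp_eq_mg_succ_cu _ _ h, cr_mg_succ _ _ (by omega), cr_cu _ _ (by omega),
    ← cr_cu_slide _ _ h, mg_cr _ _ (by omega), ← sp_eq_mg_cu_succ _ _ h,
    ← sp_eq_mg_succ_cu _ _ h]

/-- The mirror image of `sp_cr`. -/
theorem sp_succ_cr (v : Inv I n) (h : i + 2 ≤ n) :
    sp (i + 1) (cr i v) = cr i (cr (i + 1) (sp i v)) := by
  have := sp_cr i (cr i v) h
  rw [cr_cr _ _ h] at this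
  rw [this, cr_cr _ _ (by omega), cr_cr _ _ (by omega)]

variable [CharZero k]

theorem cp_sp (v : Inv I (n + 1)) (h : i ≤ n) : cp i (sp i v) = 0 := by
  have := cp_cr i (sp i v) h
  rw [cr_sp _ _ (by omega), map_neg] at this
  refine (smul_eq_zero_iff_right (two_ne_zero (α := k))).mp ?_
  rw [two_smul, add_eq_zero_iff_neg_eq]
  exact this

theorem mg_cu (v : Inv I n) (h : i ≤ n) : mg i (cu i v) = 0 := by
  have := mg_cr i (cu i v) (by omega)
  rw [cr_cu _ _ h] at this
  refine (smul_eq_zero_iff_right (two_ne_zero (α := k))).mp ?_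
  rw [two_smul, add_eq_zero_iff_eq_neg]
  exact this

end Gen

/-! ### Consequences of the Jacobi identity -/

section Jacobi

variable {k : Type u} [Field k] {δ : k} {I : TensorIdeal k (Tcat k δ 1)} {n : ℕ}

/-- The Jacobi identity of the tensor ideal, applied to the legs `i` and `i + 1`. -/
theorem mg_cr_sp (hJ : JacobiMod I) (i : ℕ) (v : Inv I (n + 1)) (h : i + 1 ≤ n) :
    mg i (cr (i + 1) (sp i v)) = sp i (mg i v) - mg i (sp (i + 1) v) := by
  have hJ' : I.toQuot (Tcat.of δ 1 Tm.dotcross) =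
      I.toQuot (Tcat.of δ 1 (Tm.add Tm.Imor (Tm.smul (-1) Tm.Hmor))) := by
    refine Eq.trans hJ ?_
    rw [sub_eq_add_neg, ← neg_one_smul k, ← map_smul, ← map_add]
    rfl
  have := DFunLike.congr_fun
    (op_congr_toQuot (N := n + 1) (N' := n + 1) (i := i) hJ' (by omega) (by omega)) v
  rw [op_add _ _ _ (by omega) (by omega), op_smul _ _ _ (by omega) (by omega), neg_one_smul,
    ← sub_eq_add_neg] at this
  unfold Tm.dotcross Tm.Imor Tm.Hmor at this
  rwa [op_comp (N' := n + 2) _ _ _ (by omega) (by omega) (by omega),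
    op_comp (N' := n + 2) _ _ _ (by omega) (by omega) (by omega),
    op_comp (N' := n) _ _ _ (by omega) (by omega) (by omega),
    op_comp (N' := n + 2) _ _ _ (by omega) (by omega) (by omega),
    op_idn_tensor _ (by omega) (by omega), op_tensor_idn _ (by omega) (by omega),
    op_idn_tensor _ (by omega) (by omega), op_tensor_idn _ (by omega) (by omega)] at this

/-- The Jacobi identity for the three ways of splitting one leg into three. -/
theorem sp_succ_sp (hJ : JacobiMod I) (i : ℕ) (v : Inv I n) (h : i + 1 ≤ n) :
    sp (i + 1) (sp i v) = sp i (sp i v) - cr (i + 1) (sp i (sp i v)) := by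
  -- bend the leg `i + 1` of the Jacobi identity to the top
  have h₁ := mg_cr_sp hJ i (cu (i + 1) v) (by omega)
  rw [sp_cu_left _ le_rfl h, cr_cu_slide _ _ (by omega), ← cr_mg_right _ le_rfl (by omega),
    ← sp_eq_mg_cu_succ _ _ (by omega), ← sp_eq_mg_cu_succ _ _ h, ← sp_succ_cu _ _ (by omega),
    ← sp_mg_right _ le_rfl (by omega), ← sp_eq_mg_cu_succ _ _ h] at h₁
  rw [h₁, sub_sub_cancel]

/-- The Jacobi identity for the three ways of merging three legs into one. -/
theorem mg_mg_succ (hJ : JacobiMod I) (i : ℕ) (v : Inv I (n + 2)) (h : i + 1 ≤ n) :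
    mg i (mg (i + 1) v) = mg i (mg i v) - mg i (mg i (cr (i + 1) v)) := by
  -- bend the top strand `i + 1` of the Jacobi identity to the bottom
  have h₁ := congrArg (cp (i + 1)) (mg_cr_sp hJ i v (by omega))
  rw [map_sub, cp_succ_sp _ _ (by omega), cp_mg_right _ (by omega) (by omega),
    cp_mg_right _ (by omega) (by omega), cp_succ_sp _ _ (by omega), cp_succ_cr _ _ (by omega),
    cr_sp_right _ le_rfl (by omega), cp_succ_sp _ _ (by omega)] at h₁
  rw [h₁, sub_sub_cancel]

theorem cr_sp_succ_sp (i : ℕ) (v : Inv I n) (h : i + 1 ≤ n) :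
    cr i (sp (i + 1) (sp i v)) = -cr (i + 1) (sp i (sp i v)) := by
  have h₁ := sp_cr i (sp i v) (by omega)
  rw [cr_sp _ _ h, map_neg] at h₁
  rw [← map_neg, h₁, cr_cr _ _ (by omega)]

theorem cr_cr_sp_sp (hJ : JacobiMod I) (i : ℕ) (v : Inv I n) (h : i + 1 ≤ n) :
    cr i (cr (i + 1) (sp i (sp i v))) = cr (i + 1) (sp i (sp i v)) - sp i (sp i v) := by
  have h₁ := congrArg (cr i) (sp_succ_sp hJ i v h)
  rw [cr_sp_succ_sp _ _ h, map_sub, cr_sp _ _ (by omega)] at h₁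
  linear_combination (norm := module) h₁

variable [CharZero k]

/-- A triangle with two legs at the top is half a vertex. -/
theorem mg_sp_succ_sp (hJ : JacobiMod I) (i : ℕ) (v : Inv I n) (h : i + 1 ≤ n) :
    mg i (sp (i + 1) (sp i v)) = (1 / 2 : k) • sp i v := by
  -- by the Jacobi identity the triangle and its twisted version add up to the vertex, and by
  -- antisymmetry the two are equal
  have h₁ := mg_cr_sp hJ i (sp i v) h
  have h₂ := mg_cr i (sp (i + 1) (sp i v)) (by omega)
  rw [cr_sp_succ_sp _ _ h, map_neg, neg_inj, h₁, mg_sp _ _ h] at h₂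
  linear_combination (norm := module) -(1 / 2 : k) • h₂

/-- A triangle with one leg at the top is half a vertex. -/
theorem mg_mg_cr_sp (hJ : JacobiMod I) (i : ℕ) (v : Inv I (n + 1)) (h : i + 1 ≤ n) :
    mg i (mg i (cr (i + 1) (sp i v))) = (1 / 2 : k) • mg i v := by
  have h₁ := congrArg (mg i) (mg_cr_sp hJ i v h)
  have h₂ := mg_mg_succ hJ i (sp (i + 1) v) h
  rw [cr_sp _ _ (by omega), map_neg, map_neg, mg_sp _ _ (by omega)] at h₂
  rw [map_sub, mg_sp _ _ h] at h₁
  linear_combination (norm := module) h₁ + (1 / 2 : k) • h₂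

end Jacobi

/-! ### Trees with three, four and five legs -/

section Trees

variable {k : Type u} [Field k] {δ : k} {I : TensorIdeal k (Tcat k δ 1)}

variable (I) in
/-- The empty diagram. -/
def empt : Inv I 0 := I.toQuot (𝟙 (⟨0⟩ : Tcat k δ 1))

variable (I) in
/-- The trivalent vertex with all three legs at the top. -/
def tri : Inv I 3 := sp 0 (cu 0 (empt I))

variable (I) in
/-- The left-normed tree with four legs. -/
def tree4 : Inv I 4 := sp 0 (tri I)

variable (I) in
/-- The left-normed tree with five legs, `[[[0, 1], 2], 3] = 4` in terms of Lie brackets. -/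
def tree : Inv I 5 := sp 0 (tree4 I)

theorem tri_eq_sp_one : tri I = sp 1 (cu 0 (empt I)) := (sp_succ_cu 0 _ le_rfl).symm

theorem cr_zero_tri : cr 0 (tri I) = -tri I := cr_sp _ _ (by omega)

theorem cr_one_tri : cr 1 (tri I) = -tri I := by
  rw [tri_eq_sp_one]
  exact cr_sp _ _ (by omega)

theorem mg_tri : mg 0 (tri I) = cu 0 (empt I) := mg_sp _ _ (by omega)

theorem sp_mg_tri : sp 0 (mg 0 (tri I)) = tri I := by rw [mg_tri, tri]

theorem mg_tree4 : mg 0 (tree4 I) = tri I := mg_sp _ _ (by omega)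

theorem mg_tree : mg 0 (tree I) = tree4 I := mg_sp _ _ (by omega)

theorem cr_zero_tree : cr 0 (tree I) = -tree I := cr_sp _ _ (by omega)

theorem cr_two_tree : cr 2 (tree I) = sp 0 (cr 1 (tree4 I)) :=
  cr_sp_right (j := 1) _ (by omega) (by omega)

/-- The root `4` and the leg `3` of the left-normed tree meet in a vertex. -/
theorem cr_three_tree : cr 3 (tree I) = -tree I := by
  rw [tree, cr_sp_right (j := 2) _ (by omega) (by omega), tree4,
    cr_sp_right (j := 1) _ (by omega) (by omega), cr_one_tri, map_neg, map_neg]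

theorem cr_braid_tree : cr 2 (cr 1 (cr 2 (tree I))) = cr 1 (cr 2 (cr 1 (tree I))) :=
  (cr_braid 1 _ (by omega)).symm

theorem sp_one_tri (hJ : JacobiMod I) : sp 1 (tri I) = tree4 I - cr 1 (tree4 I) :=
  sp_succ_sp hJ 0 _ (by omega)

theorem sp_one_tree4 (hJ : JacobiMod I) : sp 1 (tree4 I) = tree I - cr 1 (tree I) :=
  sp_succ_sp hJ 0 _ (by omega)

theorem sp_two_tree4 (hJ : JacobiMod I) : sp 2 (tree4 I) = tree I - cr 2 (tree I) := by
  rw [tree4, sp_sp_far (j := 1) _ (by omega) (by omega), sp_one_tri hJ, map_sub, cr_two_tree, tree]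

theorem sp_one_cr_one_tree4 (hJ : JacobiMod I) :
    sp 1 (cr 1 (tree4 I)) = cr 2 (cr 1 (tree I)) - cr 1 (cr 2 (cr 1 (tree I))) := by
  rw [sp_cr 1 _ (by omega), sp_two_tree4 hJ, map_sub, map_sub, cr_braid_tree]

theorem cr_zero_cr_one_tree (hJ : JacobiMod I) :
    cr 0 (cr 1 (tree I)) = cr 1 (tree I) - tree I :=
  cr_cr_sp_sp hJ 0 _ (by omega)

theorem cr_zero_cr_two_tree : cr 0 (cr 2 (tree I)) = -cr 2 (tree I) := by
  rw [← cr_cr_far _ (by omega) (by omega), cr_zero_tree, map_neg]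

theorem cr_zero_cr_two_cr_one_tree (hJ : JacobiMod I) :
    cr 0 (cr 2 (cr 1 (tree I))) = cr 2 (cr 1 (tree I)) - cr 2 (tree I) := by
  rw [← cr_cr_far _ (by omega) (by omega), cr_zero_cr_one_tree hJ, map_sub]

theorem sp_one_sp_one_tri (hJ : JacobiMod I) :
    sp 1 (sp 1 (tri I)) =
      tree I - cr 1 (tree I) - cr 2 (cr 1 (tree I)) + cr 1 (cr 2 (cr 1 (tree I))) := by
  rw [sp_one_tri hJ, map_sub, sp_one_tree4 hJ, sp_one_cr_one_tree4 hJ]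
  abel

/-- Both sides are the tree `[0, [[1, 2], 3]] = 4`. -/
theorem cr_zero_cr_one_cr_two_tree_eq_neg :
    cr 0 (cr 1 (cr 2 (tree I))) = -sp 1 (sp 1 (tri I)) := by
  have h : sp 1 (sp 1 (cr 0 (tri I))) = cr 0 (cr 1 (cr 2 (tree I))) := by
    rw [sp_succ_cr 0 _ (by omega), sp_succ_cr 0 _ (by omega), cr_two_tree, tree4]
  rw [← h, cr_zero_tri, map_neg, map_neg]

/-- The bracket `[[[1, 2], 3], 0]` in terms of left-normed brackets that start with `0`. -/
theorem cr_zero_cr_one_cr_two_tree (hJ : JacobiMod I) :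
    cr 0 (cr 1 (cr 2 (tree I))) =
      cr 1 (tree I) - tree I + cr 2 (cr 1 (tree I)) - cr 1 (cr 2 (cr 1 (tree I))) := by
  rw [cr_zero_cr_one_cr_two_tree_eq_neg, sp_one_sp_one_tri hJ]
  abel

theorem cr_zero_cr_one_cr_two_cr_one_tree (hJ : JacobiMod I) :
    cr 0 (cr 1 (cr 2 (cr 1 (tree I)))) =
      cr 2 (cr 1 (tree I)) - cr 2 (tree I) + cr 1 (tree I) - cr 1 (cr 2 (tree I)) := by
  rw [← cr_braid_tree, ← cr_cr_far _ (by omega) (by omega), cr_zero_cr_one_cr_two_tree hJ,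
    map_sub, map_add, map_sub, cr_cr 2 _ (by omega), ← cr_braid_tree, cr_cr 2 _ (by omega)]

theorem cp_one_tree : cp 1 (tree I) = tri I := by
  rw [tree, cp_succ_sp 0 _ (by omega), mg_tree4]

theorem cp_two_tree : cp 2 (tree I) = tri I := by
  rw [tree, cp_sp_right (j := 1) _ (by omega) (by omega), tree4, cp_succ_sp 0 _ (by omega),
    sp_mg_tri]

theorem cp_zero_cr_one_tree : cp 0 (cr 1 (tree I)) = -tri I := by
  rw [← cp_succ_cr 0 _ (by omega), cr_zero_tree, map_neg, zero_add, cp_one_tree]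

theorem cp_zero_cr_two_cr_one_tree : cp 0 (cr 2 (cr 1 (tree I))) = tri I := by
  rw [cp_cr_left (j := 0) _ (by omega) (by omega), cp_zero_cr_one_tree, map_neg, cr_zero_tri,
    neg_neg]

theorem cp_three_cr_two_tree : cp 3 (cr 2 (tree I)) = -tri I := by
  rw [cp_succ_cr 2 _ (by omega), cr_three_tree, map_neg, cp_two_tree]

theorem cp_three_cr_one_cr_two_tree : cp 3 (cr 1 (cr 2 (tree I))) = tri I := by
  rw [cp_cr_right _ (by omega) (by omega), cp_three_cr_two_tree, map_neg, cr_one_tri, neg_neg]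

theorem mg_mg_tree : mg 0 (mg 0 (tree I)) = tri I := by rw [mg_tree, mg_tree4]

theorem mg_cr_two_tree : mg 0 (cr 2 (tree I)) = cr 1 (tree4 I) := by
  rw [← cr_mg_right (j := 1) _ (by omega) (by omega), mg_tree]

variable [CharZero k]

theorem mg_sp_one_tri (hJ : JacobiMod I) : mg 0 (sp 1 (tri I)) = (1 / 2 : k) • tri I :=
  mg_sp_succ_sp hJ 0 _ (by omega)

theorem mg_sp_one_tree4 (hJ : JacobiMod I) : mg 0 (sp 1 (tree4 I)) = (1 / 2 : k) • tree4 I :=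
  mg_sp_succ_sp hJ 0 _ (by omega)

theorem mg_cr_one_tree4 (hJ : JacobiMod I) : mg 0 (cr 1 (tree4 I)) = (1 / 2 : k) • tri I := by
  rw [tree4, mg_cr_sp hJ 0 _ (by omega), sp_mg_tri, zero_add, mg_sp_one_tri hJ]
  module

/-! Closing up two adjacent legs of a tree. -/

theorem cp_zero_tree : cp 0 (tree I) = 0 := cp_sp _ _ (by omega)

theorem cp_one_cr_two_tree (hJ : JacobiMod I) : cp 1 (cr 2 (tree I)) = (1 / 2 : k) • tri I := by
  rw [cr_two_tree, cp_succ_sp 0 _ (by omega), mg_cr_one_tree4 hJ]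

theorem cp_zero_cr_two_tree : cp 0 (cr 2 (tree I)) = 0 := by
  rw [cp_cr_left (j := 0) _ (by omega) (by omega), cp_zero_tree, map_zero]

theorem cp_zero_cr_one_cr_two_tree (hJ : JacobiMod I) :
    cp 0 (cr 1 (cr 2 (tree I))) = -(1 / 2 : k) • tri I := by
  rw [← cp_succ_cr 0 _ (by omega), cr_zero_cr_two_tree, map_neg, zero_add, cp_one_cr_two_tree hJ,
    neg_smul]

theorem cp_zero_cr_one_cr_two_cr_one_tree (hJ : JacobiMod I) :
    cp 0 (cr 1 (cr 2 (cr 1 (tree I)))) = (1 / 2 : k) • tri I := by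
  rw [← cr_braid_tree, cp_cr_left (j := 0) _ (by omega) (by omega), cp_zero_cr_one_cr_two_tree hJ,
    map_smul, cr_zero_tri, smul_neg, neg_smul, neg_neg]

theorem cp_three_tree : cp 3 (tree I) = 0 := by
  rw [tree, cp_sp_right (j := 2) _ (by omega) (by omega), tree4,
    cp_sp_right (j := 1) _ (by omega) (by omega), tri_eq_sp_one, cp_sp _ _ (by omega), map_zero,
    map_zero]

theorem cp_three_cr_one_tree : cp 3 (cr 1 (tree I)) = 0 := by
  rw [cp_cr_right _ (by omega) (by omega), cp_three_tree, map_zero]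

theorem cp_three_cr_two_cr_one_tree (hJ : JacobiMod I) :
    cp 3 (cr 2 (cr 1 (tree I))) = -(1 / 2 : k) • tri I := by
  rw [cp_succ_cr 2 _ (by omega), cr_cr_far _ (by omega) (by omega), cr_three_tree, map_neg,
    map_neg, cp_succ_cr 1 _ (by omega), cp_one_cr_two_tree hJ, neg_smul]

theorem cp_three_cr_one_cr_two_cr_one_tree (hJ : JacobiMod I) :
    cp 3 (cr 1 (cr 2 (cr 1 (tree I)))) = (1 / 2 : k) • tri I := by
  rw [cp_cr_right _ (by omega) (by omega), cp_three_cr_two_cr_one_tree hJ, map_smul, cr_one_tri,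
    smul_neg, neg_smul, neg_neg]

/-! Merging the first three legs of a tree. -/

theorem mg_mg_cr_one_tree (hJ : JacobiMod I) :
    mg 0 (mg 0 (cr 1 (tree I))) = (1 / 2 : k) • tri I := by
  rw [tree, mg_mg_cr_sp hJ 0 _ (by omega), mg_tree4]

theorem mg_mg_cr_two_tree (hJ : JacobiMod I) :
    mg 0 (mg 0 (cr 2 (tree I))) = (1 / 2 : k) • tri I := by
  rw [mg_cr_two_tree, mg_cr_one_tree4 hJ]

theorem mg_mg_cr_one_cr_two_tree (hJ : JacobiMod I) :
    mg 0 (mg 0 (cr 1 (cr 2 (tree I)))) = (1 / 4 : k) • tri I := by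
  rw [cr_two_tree, mg_mg_cr_sp hJ 0 _ (by omega), mg_cr_one_tree4 hJ]
  module

theorem mg_mg_cr_two_cr_one_tree (hJ : JacobiMod I) :
    mg 0 (mg 0 (cr 2 (cr 1 (tree I)))) = (1 / 4 : k) • tri I := by
  rw [← cr_mg_right (j := 1) _ (by omega) (by omega), tree, mg_cr_sp hJ 0 _ (by omega),
    mg_sp_one_tree4 hJ, mg_tree4, ← tree4, map_sub, map_sub, map_smul, map_smul,
    mg_cr_one_tree4 hJ]
  module

/-- The graph on the left is `K₃,₃` with one vertex removed. It vanishes because the Jacobi identity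
at a suitable edge writes it as a difference of two graphs with triangles, which have the same
value. -/
theorem mg_mg_cr_one_cr_two_cr_one_tree (hJ : JacobiMod I) :
    mg 0 (mg 0 (cr 1 (cr 2 (cr 1 (tree I))))) = 0 := by
  have h : mg 0 (cr 1 (cr 2 (tree I))) =
      (1 / 2 : k) • tree4 I - cr 1 (mg 0 (cr 1 (tree I - cr 2 (tree I)))) := by
    rw [cr_mg_right (j := 1) _ (by omega) (by omega), ← sp_two_tree4 hJ, ← sp_cr 1 _ (by omega),
      cr_two_tree, mg_cr_sp hJ 0 _ (by omega), mg_cr_one_tree4 hJ, map_smul, tree4]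
  rw [← cr_braid_tree, ← cr_mg_right (j := 1) _ (by omega) (by omega), h, map_sub,
    cr_cr 1 _ (by omega), map_sub, map_smul, map_smul, mg_cr_one_tree4 hJ, map_sub, map_sub,
    map_sub, mg_mg_cr_one_tree hJ, mg_mg_cr_one_cr_two_tree hJ]
  module

end Trees

/-! ### A trivalent vertex next to a strand -/

section Arc

variable {k : Type u} [Field k] {δ : k} {I : TensorIdeal k (Tcat k δ 1)}

variable (I) in
/-- The diagram with five legs in which a strand joins the legs `i` and `i + d + 1`, and the other
three legs meet, from left to right, in a trivalent vertex. -/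
def arc (i : ℕ) : ℕ → Inv I 5
  | 0 => cu i (tri I)
  | d + 1 => cr (i + d + 1) (arc i d)

variable {i j d : ℕ}

theorem cr_tri (h : j + 2 ≤ 3) : cr j (tri I) = -tri I := by
  obtain rfl | rfl : j = 0 ∨ j = 1 := by omega
  · exact cr_zero_tri
  · exact cr_one_tri

theorem cr_arc_zero (h : i ≤ 3) : cr i (arc I i 0) = arc I i 0 := cr_cu _ _ h

theorem cr_arc_start (h : i + d + 3 ≤ 5) : cr i (arc I i (d + 1)) = arc I (i + 1) d := by
  induction d with
  | zero => rw [arc, arc, arc, add_zero, ← cr_cu_slide _ _ (by omega), cr_cr _ _ (by omega)]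
  | succ d ih =>
    rw [arc, ← cr_cr_far _ (by omega) (by omega), ih (by omega), arc]
    congr 2
    omega

theorem cr_arc_start' (h : i + d + 3 ≤ 5) : cr i (arc I (i + 1) d) = arc I i (d + 1) := by
  rw [← cr_arc_start h, cr_cr _ _ (by omega)]

theorem cr_arc_end (h : i + d + 3 ≤ 5) : cr (i + d + 1) (arc I i (d + 1)) = arc I i d := by
  rw [arc, cr_cr _ _ (by omega)]

theorem cr_arc_left (h : j + 2 ≤ i) (hi : i + d + 2 ≤ 5) : cr j (arc I i d) = -arc I i d := by
  induction d with
  | zero => rw [arc, cr_cu_left _ h (by omega), cr_tri (by omega), map_neg]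
  | succ d ih => rw [arc, ← cr_cr_far _ (by omega) (by omega), ih (by omega), map_neg]

theorem cr_arc_right (h : i + d + 2 ≤ j) (hj : j + 2 ≤ 5) : cr j (arc I i d) = -arc I i d := by
  induction d with
  | zero =>
    obtain ⟨j, rfl⟩ := Nat.exists_eq_add_of_le' (show 2 ≤ j by omega)
    rw [arc, cr_cu_right _ (by omega) (by omega), cr_tri (by omega), map_neg]
  | succ d ih => rw [arc, cr_cr_far _ (by omega) (by omega), ih (by omega), map_neg]

/-- Here the crossed legs belong to the vertex, and the strand passes across them. -/
theorem cr_arc_middle (h : i + 1 ≤ j) (hj : j + 1 ≤ i + d) (hd : i + d + 2 ≤ 5) :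
    cr j (arc I i d) = -arc I i d := by
  induction d with
  | zero => omega
  | succ d ih =>
    obtain h' | rfl : j + 1 ≤ i + d ∨ j = i + d := by omega
    · rw [arc, ← cr_cr_far _ (by omega) (by omega), ih h' (by omega), map_neg]
    · obtain _ | d := d
      · omega
      · rw [arc, arc, ← add_assoc, cr_braid _ _ (by omega), cr_arc_right (by omega) (by omega),
          map_neg, map_neg]

/-! Closing up two adjacent legs. -/

theorem cp_zero_arc_zero_zero : cp 0 (arc I 0 0) = δ • tri I := cp_cu _ _ (by omega)

theorem cp_zero_arc_zero_succ (h : d ≤ 2) : cp 0 (arc I 0 (d + 1)) = cp 0 (arc I 1 d) := by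
  rw [← cp_cr _ _ (by omega), cr_arc_start (by omega)]

theorem cp_zero_arc_one (h : d ≤ 2) : cp 0 (arc I 1 d) = (-1 : k) ^ d • tri I := by
  induction d with
  | zero => rw [arc, pow_zero, one_smul]; exact cp_cu_succ 0 _ (by omega)
  | succ d ih =>
    rw [arc, show 1 + d + 1 = d + 2 by omega, cp_cr_left _ (by omega) (by omega), ih (by omega),
      map_smul, cr_tri (by omega), pow_succ, mul_neg_one, smul_neg, neg_smul]

theorem cp_three_arc_three : cp 3 (arc I 3 0) = δ • tri I := cp_cu _ _ (by omega)

theorem cp_three_arc_succ (h : i + d = 2) : cp 3 (arc I i (d + 1)) = cp 3 (arc I i d) := by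
  rw [arc, h, cp_cr _ _ (by omega)]

theorem cp_three_arc (h : i + d = 2) : cp 3 (arc I i d) = (-1 : k) ^ d • tri I := by
  induction d generalizing i with
  | zero =>
    obtain rfl : i = 2 := by omega
    rw [arc, pow_zero, one_smul]
    exact cp_succ_cu 2 _ (by omega)
  | succ d ih =>
    rw [← cr_arc_start' (by omega), cp_cr_right _ (by omega) (by omega), ih (by omega), map_smul,
      cr_tri (by omega), pow_succ, mul_neg_one, smul_neg, neg_smul]

/-! Merging the first three legs. -/

theorem mg_mg_arc_zero_succ (h : d ≤ 2) :
    mg 0 (mg 0 (arc I 0 (d + 1))) = -mg 0 (mg 0 (arc I 1 d)) := by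
  rw [← cr_arc_start (i := 0) (by omega), mg_cr _ _ (by omega), map_neg, neg_neg]

theorem mg_mg_arc_one_zero : mg 0 (mg 0 (arc I 1 0)) = tri I := by
  rw [arc, ← sp_eq_mg_cu_succ 0 _ (by omega), mg_sp _ _ (by omega)]

theorem mg_mg_cr_three (v : Inv I 5) : mg 0 (mg 0 (cr 3 v)) = cr 1 (mg 0 (mg 0 v)) := by
  rw [← cr_mg_right (j := 2) _ (by omega) (by omega),
    ← cr_mg_right (j := 1) _ (by omega) (by omega)]

theorem mg_mg_arc_two_zero : mg 0 (mg 0 (arc I 2 0)) = tri I := by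
  rw [arc, mg_cu_left (j := 1) _ (by omega) (by omega), ← sp_eq_mg_cu_succ 0 _ (by omega),
    sp_mg_tri]

theorem mg_mg_arc_two_one : mg 0 (mg 0 (arc I 2 1)) = -tri I := by
  rw [arc, mg_mg_cr_three, mg_mg_arc_two_zero, cr_one_tri]

variable [CharZero k]

theorem cp_tri (h : i ≤ 1) : cp i (tri I) = 0 := by
  obtain rfl | rfl : i = 0 ∨ i = 1 := by omega
  · exact cp_sp _ _ (by omega)
  · rw [tri_eq_sp_one]
    exact cp_sp _ _ (by omega)

theorem cp_zero_arc (h : i + d ≤ 1) : cp 0 (arc I (i + 2) d) = 0 := by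
  induction d with
  | zero => rw [arc, cp_cu_left _ (by omega) (by omega), cp_tri (by omega), map_zero]
  | succ d ih =>
    rw [arc, show i + 2 + d + 1 = i + d + 1 + 2 by omega, cp_cr_left _ (by omega) (by omega),
      ih (by omega), map_zero]

theorem cp_three_arc_of_le (h : i + d ≤ 1) : cp 3 (arc I i d) = 0 := by
  induction d with
  | zero => rw [arc, cp_cu_right (j := 1) _ (by omega) (by omega), cp_tri (by omega), map_zero]
  | succ d ih =>
    rw [arc, cp_cr_right _ (by omega) (by omega), ih (by omega), map_zero]

theorem mg_mg_arc_zero_zero : mg 0 (mg 0 (arc I 0 0)) = 0 := by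
  rw [arc, mg_cu _ _ (by omega), map_zero]

theorem mg_mg_arc_one_one (hJ : JacobiMod I) :
    mg 0 (mg 0 (arc I 1 1)) = (1 / 2 : k) • tri I := by
  rw [arc, arc, ← cr_mg_right (j := 1) _ (by omega) (by omega), ← sp_eq_mg_cu_succ 0 _ (by omega),
    ← tree4, mg_cr_one_tree4 hJ]

theorem mg_mg_arc_one_two (hJ : JacobiMod I) :
    mg 0 (mg 0 (arc I 1 2)) = -(1 / 2 : k) • tri I := by
  rw [arc, mg_mg_cr_three, mg_mg_arc_one_one hJ, map_smul, cr_one_tri, smul_neg, neg_smul]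

theorem mg_mg_arc_three_zero : mg 0 (mg 0 (arc I 3 0)) = 0 := by
  rw [arc, mg_cu_left (j := 2) _ (by omega) (by omega), mg_cu_left (j := 1) _ (by omega) (by omega),
    mg_tri, mg_cu _ _ (by omega), map_zero]

end Arc

/-! ### Linear relations between the diagrams with five legs -/

section Comb

variable {k : Type u} [Field k] {δ : k} {I : TensorIdeal k (Tcat k δ 1)}

variable (I) in
/-- The linear combination, with the given coefficients, of the six trees that arise from `tree` by
permuting the legs `1`, `2`, `3`, and of the ten diagrams `arc`. -/
def comb (c : Fin 16 → k) : Inv I 5 :=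
  c 0 • tree I + c 1 • cr 1 (tree I) + c 2 • cr 2 (tree I) + c 3 • cr 1 (cr 2 (tree I)) +
    c 4 • cr 2 (cr 1 (tree I)) + c 5 • cr 1 (cr 2 (cr 1 (tree I))) +
    c 6 • arc I 0 0 + c 7 • arc I 0 1 + c 8 • arc I 0 2 + c 9 • arc I 0 3 +
    c 10 • arc I 1 0 + c 11 • arc I 1 1 + c 12 • arc I 1 2 +
    c 13 • arc I 2 0 + c 14 • arc I 2 1 + c 15 • arc I 3 0

/-- The effect of `cr 0` on the coefficients of `comb`. -/
def crCoeff₀ (c : Fin 16 → k) : Fin 16 → k :=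
  ![-c 0 - c 1 - c 3, c 1 + c 3 + c 5, -c 2 - c 4 - c 5, -c 5, c 3 + c 4 + c 5, -c 3,
    c 6, c 10, c 11, c 12, c 7, c 8, c 9, -c 13, -c 14, -c 15]

/-- The effect of `cr 1` on the coefficients of `comb`. -/
def crCoeff₁ (c : Fin 16 → k) : Fin 16 → k :=
  ![c 1, c 0, c 3, c 2, c 5, c 4, c 7, c 6, -c 8, -c 9, c 10, c 13, c 14, c 11, c 12, -c 15]

/-- The effect of `cr 2` on the coefficients of `comb`. -/
def crCoeff₂ (c : Fin 16 → k) : Fin 16 → k :=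
  ![c 2, c 4, c 0, c 5, c 1, c 3, -c 6, c 8, c 7, -c 9, c 11, c 10, -c 12, c 13, c 15, c 14]

theorem cr_zero_comb (hJ : JacobiMod I) (c : Fin 16 → k) :
    cr 0 (comb I c) = comb I (crCoeff₀ c) := by
  have h₀ : cr 0 (arc I 0 0) = arc I 0 0 := cr_arc_zero (i := 0) (by omega)
  have h₁ : cr 0 (arc I 0 1) = arc I 1 0 := cr_arc_start (by omega)
  have h₂ : cr 0 (arc I 0 2) = arc I 1 1 := cr_arc_start (by omega)
  have h₃ : cr 0 (arc I 0 3) = arc I 1 2 := cr_arc_start (by omega)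
  have h₄ : cr 0 (arc I 1 0) = arc I 0 1 := cr_arc_start' (i := 0) (by omega)
  have h₅ : cr 0 (arc I 1 1) = arc I 0 2 := cr_arc_start' (i := 0) (by omega)
  have h₆ : cr 0 (arc I 1 2) = arc I 0 3 := cr_arc_start' (i := 0) (by omega)
  have h₇ : cr 0 (arc I 2 0) = -arc I 2 0 := cr_arc_left (by omega) (by omega)
  have h₈ : cr 0 (arc I 2 1) = -arc I 2 1 := cr_arc_left (by omega) (by omega)
  have h₉ : cr 0 (arc I 3 0) = -arc I 3 0 := cr_arc_left (by omega) (by omega)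
  simp only [comb, map_add, map_smul, cr_zero_tree, cr_zero_cr_one_tree hJ, cr_zero_cr_two_tree,
    cr_zero_cr_one_cr_two_tree hJ, cr_zero_cr_two_cr_one_tree hJ,
    cr_zero_cr_one_cr_two_cr_one_tree hJ, h₀, h₁, h₂, h₃, h₄, h₅, h₆, h₇, h₈, h₉]
  simp [crCoeff₀]
  module

theorem cr_one_comb (c : Fin 16 → k) : cr 1 (comb I c) = comb I (crCoeff₁ c) := by
  have h₀ : cr 1 (arc I 0 0) = arc I 0 1 := rfl
  have h₁ : cr 1 (arc I 0 1) = arc I 0 0 := cr_arc_end (i := 0) (d := 0) (by omega)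
  have h₂ : cr 1 (arc I 0 2) = -arc I 0 2 := cr_arc_middle (by omega) (by omega) (by omega)
  have h₃ : cr 1 (arc I 0 3) = -arc I 0 3 := cr_arc_middle (by omega) (by omega) (by omega)
  have h₄ : cr 1 (arc I 1 0) = arc I 1 0 := cr_arc_zero (i := 1) (by omega)
  have h₅ : cr 1 (arc I 1 1) = arc I 2 0 := cr_arc_start (i := 1) (by omega)
  have h₆ : cr 1 (arc I 1 2) = arc I 2 1 := cr_arc_start (by omega)
  have h₇ : cr 1 (arc I 2 0) = arc I 1 1 := cr_arc_start' (i := 1) (by omega)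
  have h₈ : cr 1 (arc I 2 1) = arc I 1 2 := cr_arc_start' (i := 1) (by omega)
  have h₉ : cr 1 (arc I 3 0) = -arc I 3 0 := cr_arc_left (by omega) (by omega)
  have h : ∀ v : Inv I 5, cr 1 (cr 1 v) = v := fun v => cr_cr 1 v (by omega)
  simp only [comb, map_add, map_smul, h, h₀, h₁, h₂, h₃, h₄, h₅, h₆, h₇, h₈, h₉]
  simp [crCoeff₁]
  module

theorem cr_two_comb (c : Fin 16 → k) : cr 2 (comb I c) = comb I (crCoeff₂ c) := by
  have h₀ : cr 2 (arc I 0 0) = -arc I 0 0 := cr_arc_right (by omega) (by omega)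
  have h₁ : cr 2 (arc I 0 1) = arc I 0 2 := rfl
  have h₂ : cr 2 (arc I 0 2) = arc I 0 1 := cr_arc_end (i := 0) (d := 1) (by omega)
  have h₃ : cr 2 (arc I 0 3) = -arc I 0 3 := cr_arc_middle (by omega) (by omega) (by omega)
  have h₄ : cr 2 (arc I 1 0) = arc I 1 1 := rfl
  have h₅ : cr 2 (arc I 1 1) = arc I 1 0 := cr_arc_end (i := 1) (d := 0) (by omega)
  have h₆ : cr 2 (arc I 1 2) = -arc I 1 2 := cr_arc_middle (by omega) (by omega) (by omega)
  have h₇ : cr 2 (arc I 2 0) = arc I 2 0 := cr_arc_zero (i := 2) (by omega)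
  have h₈ : cr 2 (arc I 2 1) = arc I 3 0 := cr_arc_start (by omega)
  have h₉ : cr 2 (arc I 3 0) = arc I 2 1 := cr_arc_start' (i := 2) (by omega)
  have h : ∀ v : Inv I 5, cr 2 (cr 2 v) = v := fun v => cr_cr 2 v (by omega)
  simp only [comb, map_add, map_smul, ← cr_braid_tree, h, h₀, h₁, h₂, h₃, h₄, h₅, h₆, h₇, h₈, h₉]
  simp [crCoeff₂]
  module

variable [CharZero k]

theorem cp_zero_comb (hJ : JacobiMod I) (c : Fin 16 → k) :
    cp 0 (comb I c) = (-c 1 - 1 / 2 * c 3 + c 4 + 1 / 2 * c 5 + δ * c 6 + c 7 - c 8 + c 9 + c 10 -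
      c 11 + c 12) • tri I := by
  have h₀ : cp 0 (arc I 0 0) = δ • tri I := cp_zero_arc_zero_zero
  have h₁ : cp 0 (arc I 0 1) = cp 0 (arc I 1 0) := cp_zero_arc_zero_succ (by omega)
  have h₂ : cp 0 (arc I 0 2) = cp 0 (arc I 1 1) := cp_zero_arc_zero_succ (by omega)
  have h₃ : cp 0 (arc I 0 3) = cp 0 (arc I 1 2) := cp_zero_arc_zero_succ (by omega)
  have h₄ := cp_zero_arc_one (I := I) (d := 0) (by omega)
  have h₅ := cp_zero_arc_one (I := I) (d := 1) (by omega)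
  have h₆ := cp_zero_arc_one (I := I) (d := 2) (by omega)
  have h₇ : cp 0 (arc I 2 0) = 0 := cp_zero_arc (i := 0) (by omega)
  have h₈ : cp 0 (arc I 2 1) = 0 := cp_zero_arc (i := 0) (by omega)
  have h₉ : cp 0 (arc I 3 0) = 0 := cp_zero_arc (i := 1) (by omega)
  simp only [comb, map_add, map_smul, cp_zero_tree, cp_zero_cr_one_tree, cp_zero_cr_two_tree,
    cp_zero_cr_one_cr_two_tree hJ, cp_zero_cr_two_cr_one_tree,
    cp_zero_cr_one_cr_two_cr_one_tree hJ, h₀, h₁, h₂, h₃, h₄, h₅, h₆, h₇, h₈, h₉]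
  module

theorem cp_three_comb (hJ : JacobiMod I) (c : Fin 16 → k) :
    cp 3 (comb I c) = (-c 2 + c 3 - 1 / 2 * c 4 + 1 / 2 * c 5 + c 8 + c 9 - c 11 - c 12 + c 13 +
      c 14 + δ * c 15) • tri I := by
  have h₀ : cp 3 (arc I 0 0) = 0 := cp_three_arc_of_le (by omega)
  have h₁ : cp 3 (arc I 0 1) = 0 := cp_three_arc_of_le (by omega)
  have h₂ := cp_three_arc (I := I) (i := 0) (d := 2) (by omega)
  have h₃ : cp 3 (arc I 0 3) = cp 3 (arc I 0 2) := cp_three_arc_succ (by omega)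
  have h₄ : cp 3 (arc I 1 0) = 0 := cp_three_arc_of_le (by omega)
  have h₅ := cp_three_arc (I := I) (i := 1) (d := 1) (by omega)
  have h₆ : cp 3 (arc I 1 2) = cp 3 (arc I 1 1) := cp_three_arc_succ (by omega)
  have h₇ := cp_three_arc (I := I) (i := 2) (d := 0) (by omega)
  have h₈ : cp 3 (arc I 2 1) = cp 3 (arc I 2 0) := cp_three_arc_succ (by omega)
  simp only [comb, map_add, map_smul, cp_three_tree, cp_three_cr_one_tree, cp_three_cr_two_tree,
    cp_three_cr_one_cr_two_tree, cp_three_cr_two_cr_one_tree hJ,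
    cp_three_cr_one_cr_two_cr_one_tree hJ, h₀, h₁, h₂, h₃, h₄, h₅, h₆, h₇, h₈, cp_three_arc_three]
  module

theorem mg_mg_comb (hJ : JacobiMod I) (c : Fin 16 → k) :
    mg 0 (mg 0 (comb I c)) = (c 0 + 1 / 2 * c 1 + 1 / 2 * c 2 + 1 / 4 * c 3 + 1 / 4 * c 4 - c 7 -
      1 / 2 * c 8 + 1 / 2 * c 9 + c 10 + 1 / 2 * c 11 - 1 / 2 * c 12 + c 13 - c 14) • tri I := by
  have h₁ : mg 0 (mg 0 (arc I 0 1)) = -mg 0 (mg 0 (arc I 1 0)) := mg_mg_arc_zero_succ (by omega)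
  have h₂ : mg 0 (mg 0 (arc I 0 2)) = -mg 0 (mg 0 (arc I 1 1)) := mg_mg_arc_zero_succ (by omega)
  have h₃ : mg 0 (mg 0 (arc I 0 3)) = -mg 0 (mg 0 (arc I 1 2)) := mg_mg_arc_zero_succ (by omega)
  simp only [comb, map_add, map_smul, mg_mg_tree, mg_mg_cr_one_tree hJ, mg_mg_cr_two_tree hJ,
    mg_mg_cr_one_cr_two_tree hJ, mg_mg_cr_two_cr_one_tree hJ, mg_mg_cr_one_cr_two_cr_one_tree hJ,
    h₁, h₂, h₃, mg_mg_arc_zero_zero, mg_mg_arc_one_zero, mg_mg_arc_one_one hJ,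
    mg_mg_arc_one_two hJ, mg_mg_arc_two_zero, mg_mg_arc_two_one, mg_mg_arc_three_zero]
  module

end Comb

/-! ### Linear independence -/

section Independence

variable {k : Type u} [Field k] {δ : k} {I : TensorIdeal k (Tcat k δ 1)}

/-- If the empty diagram were in the ideal, then so would be all identities and all morphisms. -/
theorem empt_ne_zero (hI : I.QuotNontrivial) : empt I ≠ 0 := by
  intro h
  obtain ⟨X, Y, f, hf⟩ := hI
  have h₀ : 𝟙 (⟨0⟩ : Tcat k δ 1) ∈ I.hom ⟨0⟩ ⟨0⟩ := (Submodule.Quotient.mk_eq_zero _).mp h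
  have h₁ : 𝟙 X ∈ I.hom X X := by
    have := I.whiskerLeft_mem X h₀
    rwa [MonoidalCategory.whiskerLeft_id] at this
  refine hf ((Submodule.Quotient.mk_eq_zero _).mpr ?_)
  simpa using I.comp_mem h₁ f

/-- Closing up `tri` gives a circle, whose value is `δ`. -/
theorem tri_ne_zero (hI : I.QuotNontrivial) (hδ : δ ≠ 0) : tri I ≠ 0 := by
  intro h
  have h' := congrArg (cp 0) (congrArg (mg 0) h)
  rw [mg_tri, cp_cu _ _ le_rfl, map_zero, map_zero] at h'
  exact (smul_ne_zero hδ (empt_ne_zero hI)) h'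

/-! The coefficients of the linear relations form a subspace that is stable under the symmetries. -/

theorem comb_crCoeff₀ (hJ : JacobiMod I) {c : Fin 16 → k} (h : comb I c = 0) :
    comb I (crCoeff₀ c) = 0 := by
  rw [← cr_zero_comb hJ, h, map_zero]

theorem comb_crCoeff₁ {c : Fin 16 → k} (h : comb I c = 0) : comb I (crCoeff₁ c) = 0 := by
  rw [← cr_one_comb, h, map_zero]

theorem comb_crCoeff₂ {c : Fin 16 → k} (h : comb I c = 0) : comb I (crCoeff₂ c) = 0 := by
  rw [← cr_two_comb, h, map_zero]

variable [CharZero k]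

/-- The equation that merging the first three legs gives for the coefficients of a relation. -/
theorem mg_mg_coeff_eq_zero (hI : I.QuotNontrivial) (hJ : JacobiMod I) (hδ : δ ≠ 0)
    {c : Fin 16 → k} (h : comb I c = 0) :
    c 0 + 1 / 2 * c 1 + 1 / 2 * c 2 + 1 / 4 * c 3 + 1 / 4 * c 4 - c 7 - 1 / 2 * c 8 +
      1 / 2 * c 9 + c 10 + 1 / 2 * c 11 - 1 / 2 * c 12 + c 13 - c 14 = 0 := by
  have := mg_mg_comb hJ c
  rw [h, map_zero, map_zero] at this
  exact (smul_eq_zero_iff_left (tri_ne_zero hI hδ)).mp this.symm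

/-- The contraction of the legs `0` and `1`, corrected by the tree functionals, only sees the
coefficient of `arc 0 0`. -/
theorem coeff_arc_zero_zero (hI : I.QuotNontrivial) (hJ : JacobiMod I) (hδ : δ ≠ 0) (hδ' : δ ≠ 3)
    {c : Fin 16 → k} (h : comb I c = 0) : c 6 = 0 := by
  have h₁ := comb_crCoeff₁ h
  have h₂ := comb_crCoeff₂ h
  have e := cp_zero_comb hJ c
  rw [h, map_zero] at e
  replace e := (smul_eq_zero_iff_left (tri_ne_zero hI hδ)).mp e.symm
  have e₀ := mg_mg_coeff_eq_zero hI hJ hδ h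
  have e₁ := mg_mg_coeff_eq_zero hI hJ hδ h₁
  have e₂ := mg_mg_coeff_eq_zero hI hJ hδ h₂
  have e₁₂ := mg_mg_coeff_eq_zero hI hJ hδ (comb_crCoeff₁ h₂)
  have e₂₁ := mg_mg_coeff_eq_zero hI hJ hδ (comb_crCoeff₂ h₁)
  have e₁₂₁ := mg_mg_coeff_eq_zero hI hJ hδ (comb_crCoeff₁ (comb_crCoeff₂ h₁))
  simp [crCoeff₁, crCoeff₂] at e₁ e₂ e₁₂ e₂₁ e₁₂₁
  refine (mul_eq_zero_iff_left (sub_ne_zero.mpr hδ')).mp ?_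
  -- the row of the inverse Gram matrix that belongs to this coefficient, multiplied by `δ - 3`
  linear_combination e - e₀ + e₁ + e₂ - e₁₂ + e₂₁ - e₁₂₁

/-- The contraction of the legs `3` and `4`, corrected by the tree functionals, only sees the
coefficient of `arc 3 0`. -/
theorem coeff_arc_three_zero (hI : I.QuotNontrivial) (hJ : JacobiMod I) (hδ : δ ≠ 0)
    (hδ' : δ ≠ 3) {c : Fin 16 → k} (h : comb I c = 0) : c 15 = 0 := by
  have h₁ := comb_crCoeff₁ h
  have h₂ := comb_crCoeff₂ h
  have e := cp_three_comb hJ c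
  rw [h, map_zero] at e
  replace e := (smul_eq_zero_iff_left (tri_ne_zero hI hδ)).mp e.symm
  have e₀ := mg_mg_coeff_eq_zero hI hJ hδ h
  have e₁ := mg_mg_coeff_eq_zero hI hJ hδ h₁
  have e₂ := mg_mg_coeff_eq_zero hI hJ hδ h₂
  have e₁₂ := mg_mg_coeff_eq_zero hI hJ hδ (comb_crCoeff₁ h₂)
  have e₂₁ := mg_mg_coeff_eq_zero hI hJ hδ (comb_crCoeff₂ h₁)
  have e₁₂₁ := mg_mg_coeff_eq_zero hI hJ hδ (comb_crCoeff₁ (comb_crCoeff₂ h₁))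
  simp [crCoeff₁, crCoeff₂] at e₁ e₂ e₁₂ e₂₁ e₁₂₁
  refine (mul_eq_zero_iff_left (sub_ne_zero.mpr hδ')).mp ?_
  -- the row of the inverse Gram matrix that belongs to this coefficient, multiplied by `δ - 3`
  linear_combination e - e₀ + e₁ + e₂ + e₁₂ - e₂₁ - e₁₂₁

/-- The symmetries move `arc 0 0` and `arc 3 0` to all other diagrams `arc`. -/
theorem coeff_arc (hI : I.QuotNontrivial) (hJ : JacobiMod I) (hδ : δ ≠ 0) (hδ' : δ ≠ 3)
    {c : Fin 16 → k} (h : comb I c = 0) :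
    c 6 = 0 ∧ c 7 = 0 ∧ c 8 = 0 ∧ c 9 = 0 ∧ c 10 = 0 ∧ c 11 = 0 ∧ c 12 = 0 ∧ c 13 = 0 ∧
      c 14 = 0 ∧ c 15 = 0 := by
  have h₁ := comb_crCoeff₁ h
  have h₂ := comb_crCoeff₂ h
  have a := fun {c : Fin 16 → k} => coeff_arc_zero_zero (c := c) hI hJ hδ hδ'
  have b := fun {c : Fin 16 → k} => coeff_arc_three_zero (c := c) hI hJ hδ hδ'
  have h₀ := comb_crCoeff₀ hJ h
  exact ⟨a h, a h₁, a (comb_crCoeff₁ h₂), b (comb_crCoeff₂ (comb_crCoeff₁ h₀)),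
    a (comb_crCoeff₁ h₀), a (comb_crCoeff₁ (comb_crCoeff₂ h₀)), b (comb_crCoeff₂ h₁),
    a (comb_crCoeff₁ (comb_crCoeff₀ hJ (comb_crCoeff₂ h₁))), b h₂, b h⟩

/-- Once the coefficients of the diagrams `arc` vanish, the six permuted tree functionals determine
those of the trees. By symmetry one of these suffices. -/
theorem coeff_tree (hI : I.QuotNontrivial) (hJ : JacobiMod I) (hδ : δ ≠ 0) (hδ' : δ ≠ 3)
    {c : Fin 16 → k} (h : comb I c = 0) : c 0 = 0 := by
  have h₁ := comb_crCoeff₁ h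
  have h₂ := comb_crCoeff₂ h
  obtain ⟨d₆, d₇, d₈, d₉, d₁₀, d₁₁, d₁₂, d₁₃, d₁₄, d₁₅⟩ := coeff_arc hI hJ hδ hδ' h
  have e₀ := mg_mg_coeff_eq_zero hI hJ hδ h
  have e₁ := mg_mg_coeff_eq_zero hI hJ hδ h₁
  have e₂ := mg_mg_coeff_eq_zero hI hJ hδ h₂
  have e₁₂ := mg_mg_coeff_eq_zero hI hJ hδ (comb_crCoeff₁ h₂)
  have e₂₁ := mg_mg_coeff_eq_zero hI hJ hδ (comb_crCoeff₂ h₁)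
  have e₁₂₁ := mg_mg_coeff_eq_zero hI hJ hδ (comb_crCoeff₁ (comb_crCoeff₂ h₁))
  simp [crCoeff₁, crCoeff₂, d₆, d₇, d₈, d₉, d₁₀, d₁₁, d₁₂, d₁₃, d₁₄, d₁₅] at e₀ e₁ e₂ e₁₂ e₂₁ e₁₂₁
  -- the first row of the inverse of the six by six matrix of the tree functionals on the trees
  linear_combination 2 * e₀ - 4 / 5 * e₁ - 4 / 5 * e₂ - 2 / 5 * e₁₂ - 2 / 5 * e₂₁ + 4 / 5 * e₁₂₁

theorem coeff_eq_zero (hI : I.QuotNontrivial) (hJ : JacobiMod I) (hδ : δ ≠ 0) (hδ' : δ ≠ 3)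
    {c : Fin 16 → k} (h : comb I c = 0) : c = 0 := by
  have h₁ := comb_crCoeff₁ h
  have h₂ := comb_crCoeff₂ h
  have a := fun {c : Fin 16 → k} => coeff_tree (c := c) hI hJ hδ hδ'
  obtain ⟨d₆, d₇, d₈, d₉, d₁₀, d₁₁, d₁₂, d₁₃, d₁₄, d₁₅⟩ := coeff_arc hI hJ hδ hδ' h
  have t₁ : c 1 = 0 := a h₁
  have t₂ : c 2 = 0 := a h₂
  have t₃ : c 3 = 0 := a (comb_crCoeff₂ h₁)
  have t₄ : c 4 = 0 := a (comb_crCoeff₁ h₂)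
  have t₅ : c 5 = 0 := a (comb_crCoeff₁ (comb_crCoeff₂ h₁))
  ext i
  fin_cases i <;> first | exact a h | assumption

end Independence

/-! ### Bending the two bottom strands of the sixteen diagrams to the top -/

section Bend

variable {k : Type u} [Field k] {δ : k} {I : TensorIdeal k (Tcat k δ 1)}

variable (I) in
/-- Two nested cups: the identity of two strands with its bottom bent to the left. -/
def nest : Inv I 4 := cu 1 (cu 0 (empt I))

theorem mg_nest : mg 2 (nest I) = tri I := by
  rw [nest, ← sp_eq_mg_succ_cu 1 _ (by omega), tri_eq_sp_one]

theorem sp_three_nest : sp 3 (nest I) = arc I 1 0 := by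
  rw [nest, sp_cu_right (j := 1) _ (by omega) (by omega), ← tri_eq_sp_one, arc]

/-- Nested cups are cups side by side, with one end of the first moved across the second. -/
theorem nest_eq_cr : nest I = cr 2 (cr 1 (cu 0 (cu 0 (empt I)))) := by
  rw [← cr_cu_slide 0 _ (by omega), cr_cr_far _ (by omega) (by omega), ← cr_cu_slide 1 _ (by omega),
    show cu (1 + 1) (cu 0 (empt I)) = cu 0 (cu 0 (empt I)) from cu_cu_same _ (by omega),
    ← cr_cu_slide 0 _ (by omega), cr_cr 0 _ (by omega), nest]

theorem sp_two_nest : sp 2 (nest I) = arc I 0 3 := by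
  rw [nest_eq_cr, sp_cr 2 _ (by omega), sp_cr_left _ (by omega) (by omega),
    sp_cu_right (j := 1) _ (by omega) (by omega), ← tri_eq_sp_one]
  rfl

theorem sp_two_tri : sp 2 (tri I) = tree4 I := by
  rw [tri, sp_sp_far (j := 1) _ (by omega) (by omega), ← tri_eq_sp_one, tree4]

theorem sp_three_tree4 : sp 3 (tree4 I) = tree I := by
  rw [tree4, sp_sp_far (j := 2) _ (by omega) (by omega), sp_two_tri, tree]

theorem mg_sp_sp_three_nest : mg 3 (sp 2 (arc I 1 0)) = sp 1 (sp 1 (tri I)) := by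
  rw [arc, sp_succ_cu 1 _ (by omega), ← sp_mg_left _ (by omega) (by omega),
    ← sp_eq_mg_succ_cu 1 _ (by omega)]

theorem mg_two_arc_one_zero : mg 2 (arc I 1 0) = sp 1 (tri I) := by
  rw [arc, ← sp_eq_mg_succ_cu 1 _ (by omega)]

theorem sp_two_cr_nest : sp 2 (cr 2 (nest I)) = arc I 1 2 := by
  rw [sp_cr 2 _ (by omega), sp_three_nest]
  rfl

theorem sp_three_cr_nest : sp 3 (cr 2 (nest I)) = arc I 0 1 := by
  rw [sp_succ_cr 2 _ (by omega), sp_two_nest, cr_arc_end (i := 0) (d := 2) (by omega)]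
  exact cr_arc_end (i := 0) (d := 1) (by omega)

variable (I) in
/-- The diagrams of `diagrams`, with their bottom strands bent to the left and up. -/
def bent (i : Fin 16) : Inv I 5 := op I 4 5 2 (diagrams k i) (nest I)

theorem bent_0 (hJ : JacobiMod I) : bent I 0 =
    tree I - cr 1 (tree I) - cr 2 (cr 1 (tree I)) + cr 1 (cr 2 (cr 1 (tree I))) := by
  simp only [bent, diagrams, Matrix.cons_val]
  rw [op_comp (N' := 6) _ _ _ (by omega) (by omega) (by omega),
    op_idn_tensor _ (by omega) (by omega), op_tensor_idn _ (by omega) (by omega),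
    op_tensor' (N' := 5) _ _ _ (by omega) (by omega) (by omega)]
  rw [← sp_one_sp_one_tri hJ, ← mg_sp_sp_three_nest, ← sp_three_nest]
  rfl

theorem bent_1 (hJ : JacobiMod I) : bent I 1 = tree I - cr 2 (tree I) := by
  simp only [bent, diagrams, Matrix.cons_val]
  rw [op_comp (N' := 3) _ _ _ (by omega) (by omega) (by omega),
    op_comp (N' := 4) _ _ _ (by omega) (by omega) (by omega),
    op_tensor_idn _ (by omega) (by omega)]
  have h : sp 2 (sp 2 (mg 2 (nest I))) = tree I - cr 2 (tree I) := by
    rw [mg_nest, sp_two_tri, sp_two_tree4 hJ]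
  exact h

theorem bent_2 : bent I 2 = tree I := by
  simp only [bent, diagrams, Matrix.cons_val]
  rw [op_comp (N' := 3) _ _ _ (by omega) (by omega) (by omega),
    op_comp (N' := 4) _ _ _ (by omega) (by omega) (by omega),
    op_idn_tensor _ (by omega) (by omega)]
  have h : sp 3 (sp 2 (mg 2 (nest I))) = tree I := by
    rw [mg_nest, sp_two_tri, sp_three_tree4]
  exact h

theorem bent_3 (hJ : JacobiMod I) : bent I 3 = tree I - cr 1 (tree I) := by
  simp only [bent, diagrams, Matrix.cons_val]
  rw [op_comp (N' := 5) _ _ _ (by omega) (by omega) (by omega),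
    op_comp (N' := 4) _ _ _ (by omega) (by omega) (by omega),
    op_idn_tensor _ (by omega) (by omega),
    op_idn_tensor _ (by omega) (by omega),
    op_tensor_idn _ (by omega) (by omega)]
  have h : sp 3 (mg 3 (sp 2 (nest I))) = tree I - cr 1 (tree I) := by
    rw [nest, sp_succ_cu 1 _ (by omega), ← sp_mg_left _ (by omega) (by omega), ← nest, mg_nest,
      sp_sp_far (j := 2) _ (by omega) (by omega), sp_two_tri, sp_one_tree4 hJ]
  exact h

theorem bent_4 (hJ : JacobiMod I) : bent I 4 =
    tree I - cr 2 (tree I) - cr 1 (cr 2 (tree I)) + cr 1 (cr 2 (cr 1 (tree I))) := by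
  simp only [bent, diagrams, Matrix.cons_val]
  rw [op_comp (N' := 5) _ _ _ (by omega) (by omega) (by omega),
    op_comp (N' := 4) _ _ _ (by omega) (by omega) (by omega),
    op_idn_tensor _ (by omega) (by omega),
    op_tensor_idn _ (by omega) (by omega),
    op_tensor_idn _ (by omega) (by omega)]
  have h : sp 2 (mg 2 (sp 3 (nest I))) =
      tree I - cr 2 (tree I) - cr 1 (cr 2 (tree I)) + cr 1 (cr 2 (cr 1 (tree I))) := by
    rw [sp_three_nest, mg_two_arc_one_zero, sp_succ_sp hJ 1 _ (by omega), sp_one_sp_one_tri hJ,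
      ← cr_braid_tree]
    simp only [map_add, map_sub, cr_cr 2 _ (show 2 + 2 ≤ 5 by omega)]
    abel
  exact h

theorem bent_5 : bent I 5 = arc I 0 0 := by
  simp only [bent, diagrams, Matrix.cons_val]
  rw [op_comp (N' := 2) _ _ _ (by omega) (by omega) (by omega),
    op_comp (N' := 4) _ _ _ (by omega) (by omega) (by omega),
    op_idn_tensor _ (by omega) (by omega)]
  have h : sp 3 (cu 2 (cp 2 (nest I))) = arc I 0 0 := by
    rw [nest, cp_succ_cu 1 _ (by omega), cu_cu_same _ (by omega),
      sp_cu_right (j := 1) _ (by omega) (by omega), ← tri_eq_sp_one, arc]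
  exact h

theorem bent_6 : bent I 6 = arc I 1 0 := by
  simp only [bent, diagrams, Matrix.cons_val]
  rw [op_idn_tensor _ (by omega) (by omega)]
  exact sp_three_nest

theorem bent_7 : bent I 7 = arc I 0 3 := by
  simp only [bent, diagrams, Matrix.cons_val]
  rw [op_tensor_idn _ (by omega) (by omega)]
  exact sp_two_nest

theorem bent_8 : bent I 8 = arc I 2 0 := by
  simp only [bent, diagrams, Matrix.cons_val]
  rw [op_tensor' (N' := 3) _ _ _ (by omega) (by omega) (by omega)]
  exact congrArg (cu 2) mg_nest

theorem bent_9 : bent I 9 = arc I 3 0 := by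
  simp only [bent, diagrams, Matrix.cons_val]
  rw [op_tensor (N' := 3) _ _ _ (by omega) (by omega) (by omega)]
  exact congrArg (cu 3) mg_nest

theorem bent_10 : bent I 10 = arc I 2 1 := by
  simp only [bent, diagrams, Matrix.cons_val]
  rw [op_comp (N' := 3) _ _ _ (by omega) (by omega) (by omega),
    op_comp (N' := 5) _ _ _ (by omega) (by omega) (by omega),
    op_tensor_idn _ (by omega) (by omega),
    op_idn_tensor _ (by omega) (by omega)]
  exact congrArg (fun v => cr 3 (cu 2 v)) mg_nest

theorem bent_11 : bent I 11 = arc I 0 2 := by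
  simp only [bent, diagrams, Matrix.cons_val]
  rw [op_comp (N' := 5) _ _ _ (by omega) (by omega) (by omega),
    op_tensor_idn _ (by omega) (by omega),
    op_idn_tensor _ (by omega) (by omega)]
  exact (congrArg (cr 3) sp_two_nest).trans (cr_arc_end (i := 0) (d := 2) (by omega))

theorem bent_12 : bent I 12 = arc I 1 1 := by
  simp only [bent, diagrams, Matrix.cons_val]
  rw [op_comp (N' := 5) _ _ _ (by omega) (by omega) (by omega),
    op_tensor_idn _ (by omega) (by omega),
    op_idn_tensor _ (by omega) (by omega)]
  exact congrArg (cr 2) sp_three_nest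

theorem bent_13 : bent I 13 = arc I 1 2 := by
  simp only [bent, diagrams, Matrix.cons_val]
  rw [op_comp (N' := 4) _ _ _ (by omega) (by omega) (by omega),
    op_tensor_idn _ (by omega) (by omega)]
  exact sp_two_cr_nest

theorem bent_14 : bent I 14 = arc I 0 1 := by
  simp only [bent, diagrams, Matrix.cons_val]
  rw [op_comp (N' := 4) _ _ _ (by omega) (by omega) (by omega),
    op_idn_tensor _ (by omega) (by omega)]
  exact sp_three_cr_nest

theorem bent_15 : bent I 15 = -cr 1 (cr 2 (tree I)) := by
  simp only [bent, diagrams, Matrix.cons_val]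
  rw [op_comp (N' := 4) _ _ _ (by omega) (by omega) (by omega),
    op_comp (N' := 6) _ _ _ (by omega) (by omega) (by omega),
    op_idn_tensor _ (by omega) (by omega),
    op_tensor_idn _ (by omega) (by omega),
    op_tensor' (N' := 5) _ _ _ (by omega) (by omega) (by omega)]
  have h : mg 3 (sp 2 (sp 3 (cr 2 (nest I)))) = -cr 1 (cr 2 (tree I)) := by
    rw [sp_three_cr_nest, ← cr_arc_start' (i := 0) (by omega), sp_cr_left _ (by omega) (by omega),
      mg_cr_left _ (by omega) (by omega), mg_sp_sp_three_nest, ← neg_eq_iff_eq_neg, ← map_neg,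
      ← cr_zero_cr_one_cr_two_tree_eq_neg, cr_cr 0 _ (by omega)]
  exact h

/-- A linear relation in the quotient category can be bent. -/
theorem sum_smul_bent_eq_zero {c : Fin 16 → k}
    (h : ∑ i, c i • I.toQuot (Tcat.of δ 1 (diagrams k i)) = 0) : ∑ i, c i • bent I i = 0 := by
  obtain ⟨g, hg⟩ := toQuot_surjective (nest I)
  have := congrArg (attach I (m := 2) (n := 3) 2 0 g) h
  simp only [map_sum, map_smul, map_zero, attach_of, hg] at this
  exact this

end Bend

theorem linearIndependent_diagrams {k : Type u} [Field k] [CharZero k] {δ : k} (hδ : δ ≠ 0)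
    (hδ' : δ ≠ 3) {I : TensorIdeal k (Tcat k δ 1)} (hI : I.QuotNontrivial) (hJ : JacobiMod I) :
    LinearIndependent k (fun i : Fin 16 => I.toQuot (Tcat.of δ 1 (diagrams k i))) := by
  rw [Fintype.linearIndependent_iff]
  intro c hc
  have h := sum_smul_bent_eq_zero hc
  -- the entries are the coefficients of the bent relation, as read off from `bent_0`, …, `bent_15`
  have h' : comb I ![c 0 + c 1 + c 2 + c 3 + c 4, -c 0 - c 3, -c 1 - c 4, -c 4 - c 15, -c 0,
      c 0 + c 4, c 5, c 14, c 11, c 7, c 6, c 12, c 13, c 8, c 10, c 9] = 0 := by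
    rw [← h]
    simp only [Fin.sum_univ_succ, Fin.sum_univ_zero, Fin.succ_zero_eq_one]
    simp [comb, bent_0 hJ, bent_1 hJ, bent_2, bent_3 hJ, bent_4 hJ, bent_5, bent_6, bent_7, bent_8,
      bent_9, bent_10, bent_11, bent_12, bent_13, bent_14, bent_15]
    module
  have e := congrFun (coeff_eq_zero hI hJ hδ hδ' h')
  have e₀ : c 0 + c 1 + c 2 + c 3 + c 4 = 0 := e 0
  have e₁ : -c 0 - c 3 = 0 := e 1
  have e₂ : -c 1 - c 4 = 0 := e 2
  have e₃ : -c 4 - c 15 = 0 := e 3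
  have e₄ : -c 0 = 0 := e 4
  have e₅ : c 0 + c 4 = 0 := e 5
  have f₀ : c 0 = 0 := by linear_combination -e₄
  have f₁ : c 1 = 0 := by linear_combination -e₂ - e₅ - e₄
  have f₂ : c 2 = 0 := by linear_combination e₀ + e₁ + e₂
  have f₃ : c 3 = 0 := by linear_combination e₄ - e₁
  have f₄ : c 4 = 0 := by linear_combination e₅ + e₄
  have f₁₅ : c 15 = 0 := by linear_combination -e₃ - e₅ - e₄
  intro i
  fin_cases i
  exacts [f₀, f₁, f₂, f₃, f₄, e 6, e 10, e 9, e 13, e 15, e 14, e 8, e 11, e 12, e 7, f₁₅]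

end Trivalent

theorem mainTheorem10 (δ : ℂ) (h₁ : δ ≠ -2) (h₂ : δ ≠ 0) (h₃ : δ ≠ 3)
    (h₄ : δ ≠ (15 + 3 * (Real.sqrt 5 : ℂ)) / 4) (h₅ : δ ≠ (15 - 3 * (Real.sqrt 5 : ℂ)) / 4)
    (I : Trivalent.TensorIdeal ℂ (Trivalent.Tcat ℂ δ 1)) (hI : I.QuotNontrivial)
    (hJ : Trivalent.JacobiMod I) :
    LinearIndependent ℂ
      (fun i : Fin 16 => I.toQuot (Trivalent.Tcat.of δ 1 (Trivalent.diagrams ℂ i))) :=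
  Trivalent.linearIndependent_diagrams h₂ h₃ hI hJ
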